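/- Let $1\le p<\infty$ with $p\neq 2$, and let $$H_p(\mathbb{T})=\Big\{f\in L_p(\mathbb{T}) : \tfrac1{2\pi}\int_0^{2\pi} f(e^{i\theta})e^{in\theta}\,d\theta=0 \text{ for all integers } n\ge 1\Big\}$$ be the (complex) Hardy space of the circle $\mathbb{T}$, with the norm of $L_p(\mathbb{T})$. Then $H_p(\mathbb{T})$ has no Schauder basis with basis constant $1$. That is, there is no Schauder basis $(e_k)_{k\ge 0}$ of $H_p(\mathbb{T})$, with coordinate functionals $(e_k^*)_{k\ge 0}$, whose partial-sum projections $P_n f=\sum_{k<n}e_k^*(f)\,e_k$ satisfy $\sup_n\|P_n\|=1$. -/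

import Mathlib

open MeasureTheory AddCircle
open scoped ENNReal

instance fact_two_pi_pos : Fact (0 < 2 * Real.pi) := ⟨Real.two_pi_pos⟩

/-- The Hardy space `H_p(𝕋)` for `1 ≤ p ≤ ∞`, as the complex subspace of `L_p(𝕋)` of all `f` whose
Fourier coefficients of negative index vanish. The circle `𝕋` is `ℝ / 2πℤ` (the variable is `θ`,
standing for the point `e^{iθ}`), with its rotation-invariant probability measure, and
`fourierCoeff f k` is the integral of `f(θ) e^{-ikθ}`. The norm is the one inherited
from `L_p(𝕋)`. -/
noncomputable def hardySpace (p : ℝ≥0∞) [Fact (1 ≤ p)] :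
    Submodule ℂ (Lp ℂ p (haarAddCircle : Measure (AddCircle (2 * Real.pi)))) where
  carrier := {f | ∀ n : ℕ, 1 ≤ n → fourierCoeff (f : AddCircle (2 * Real.pi) → ℂ) (-(n : ℤ)) = 0}
  zero_mem' := by
    intro n _
    have h : (fun t => fourier (-(-(n : ℤ))) t •
        (0 : Lp ℂ p (haarAddCircle : Measure (AddCircle (2 * Real.pi)))) t)
        =ᵐ[haarAddCircle] 0 := by
      filter_upwards [Lp.coeFn_zero ℂ p (haarAddCircle : Measure (AddCircle (2 * Real.pi)))]
        with t ht
      rw [ht]; simp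
    rw [fourierCoeff, integral_congr_ae h]; simp
  add_mem' := by
    intro f g hf hg n hn
    have h : (fun t => fourier (-(-(n : ℤ))) t • (f + g) t) =ᵐ[haarAddCircle]
        (fun t => fourier (-(-(n : ℤ))) t • ((f : AddCircle (2 * Real.pi) → ℂ) + g) t) := by
      filter_upwards [Lp.coeFn_add f g] with t ht
      rw [ht]
    have hfi : Integrable f haarAddCircle := (Lp.memLp f).integrable Fact.out
    have hgi : Integrable g haarAddCircle := (Lp.memLp g).integrable Fact.out
    rw [fourierCoeff, integral_congr_ae h, ← fourierCoeff, fourierCoeff.add hfi hgi,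
      Pi.add_apply, hf n hn, hg n hn, add_zero]
  smul_mem' := by
    intro c f hf n hn
    have h : (fun t => fourier (-(-(n : ℤ))) t • (c • f) t) =ᵐ[haarAddCircle]
        (fun t => fourier (-(-(n : ℤ))) t • (c • (f : AddCircle (2 * Real.pi) → ℂ)) t) := by
      filter_upwards [Lp.coeFn_smul c f] with t ht
      rw [ht]
    rw [fourierCoeff, integral_congr_ae h, ← fourierCoeff, fourierCoeff.const_smul,
      hf n hn, smul_zero]

local notation "𝕋" => AddCircle (2 * Real.pi)
local notation "μH" => (haarAddCircle : Measure (AddCircle (2 * Real.pi)))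

open Filter Topology ComplexConjugate

/-! For a basis with constant 1, the projection `P` onto the span `V` of the first two basis vectors
is contractive. It is shown that `H_p` with `p ≠ 2` admits no contractive projection onto a
two-dimensional subspace.

Write `q` for the exponent, `J(z) = |z|^(q-2) z̄` for the duality map, `e_n` for `fourier n`, and `φ
= g/f` for a basis `f, g` of `V`. Elements of `V` other than 0 are nonzero a.e.
(`ae_ne_zero_of_analytic`), so the norm is differentiable at them, even for `q = 1`, and
contractivity says that `J(F)` annihilates `ker P` for every such `F`. In particular `∫ J(F) (e_n y
- P(e_n y)) = 0` for `y ∈ V` and `n ≥ 0`. Call `K` good if it has this property in place of `J(F)`.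
A good `K` that annihilates `V` annihilates every `e_n y`, so `K y` is analytic with mean zero; if
`K y` is also real, it vanishes (`IsGood.ae_eq_zero_of_real`). Annihilating `V` is a finite system
of linear equations, so sufficiently many good functions with `K f` real satisfy a nontrivial real
linear relation.

Good functions come from differentiating `J(f + t g)` in `t`. For `q < 2` the first derivative gives
the functions `J(g) |f/g + t|^(q-2)` for almost all `t`; four of them are dependent, which is absurd
because each dominates the others near its own singularity. For `q > 2` the first and second
derivatives give `J(f)` times `1`, `Re φ`, `Im φ`, `|φ|²`; their dependence puts `φ` on a line or a
circle. After an affine change of basis `φ` is real or unimodular, and a further relation is a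
nonzero polynomial equation for `φ`. This is impossible, since `g - c f` is nonzero a.e. for each
constant `c`. -/

/-! ### Integrable functions are determined by their Fourier coefficients. -/

theorem integral_thickenedIndicator_smul_tendsto {E : Type*} [NormedAddCommGroup E]
    [NormedSpace ℝ E] {k : 𝕋 → E} (hk : Integrable k μH) {K : Set 𝕋} (hK : IsClosed K) :
    Tendsto (fun n : ℕ => ∫ x, ((thickenedIndicator (Nat.one_div_pos_of_nat (α := ℝ) (n := n)) K x :
      NNReal) : ℝ) • k x ∂μH) atTop (𝓝 (∫ x in K, k x ∂μH)) := by
  rw [← integral_indicator hK.measurableSet]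
  refine tendsto_integral_of_dominated_convergence (fun x => ‖k x‖) ?_ hk.norm ?_ ?_
  · intro n
    refine AEStronglyMeasurable.smul ?_ hk.1
    exact (NNReal.continuous_coe.comp (thickenedIndicator _ K).continuous).aestronglyMeasurable
  · intro n
    refine ae_of_all _ fun x => ?_
    rw [norm_smul]
    have h1 := thickenedIndicator_le_one (Nat.one_div_pos_of_nat (α := ℝ) (n := n)) K x
    refine mul_le_of_le_one_left (norm_nonneg _) ?_
    simpa using! h1
  · refine ae_of_all _ fun x => ?_
    have h := tendsto_pi_nhds.1 (thickenedIndicator_tendsto_indicator_closure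
      (fun n : ℕ => Nat.one_div_pos_of_nat (α := ℝ) (n := n))
      tendsto_one_div_add_atTop_nhds_zero_nat K) x
    have h2 := ((NNReal.continuous_coe.tendsto _).comp h).smul_const (k x)
    have h3 : K.indicator k x = (((closure K).indicator (fun _ => (1 : NNReal)) x : NNReal) : ℝ) • k x := by
      rw [hK.closure_eq]
      by_cases hx : x ∈ K <;> simp [hx]
    rw [h3]
    exact h2

/-- An integrable function on the circle orthogonal to all continuous functions vanishes. -/
theorem ae_eq_zero_of_forall_integral_continuous {k : 𝕋 → ℂ} (hk : Integrable k μH)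
    (h : ∀ v : C(𝕋, ℂ), ∫ x, v x * k x ∂μH = 0) : k =ᵐ[μH] 0 := by
  refine ae_eq_zero_of_forall_setIntegral_isClosed_eq_zero hk fun K hK => ?_
  refine tendsto_nhds_unique (integral_thickenedIndicator_smul_tendsto hk hK) ?_
  refine tendsto_const_nhds.congr fun n => ?_
  have := h ⟨fun x => (((thickenedIndicator (Nat.one_div_pos_of_nat (α := ℝ) (n := n)) K x :
      NNReal) : ℝ) : ℂ), by
    exact Complex.continuous_ofReal.comp
      (NNReal.continuous_coe.comp (thickenedIndicator _ K).continuous)⟩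
  rw [← this]
  simp

/-- An integrable function all of whose Fourier coefficients vanish is zero. -/
theorem ae_eq_zero_of_forall_integral_fourier {k : 𝕋 → ℂ} (hk : Integrable k μH)
    (h : ∀ n : ℤ, ∫ x, fourier n x * k x ∂μH = 0) : k =ᵐ[μH] 0 := by
  have hint : ∀ v : C(𝕋, ℂ), Integrable (fun x => v x * k x) μH := fun v =>
    hk.bdd_mul (c := ‖v‖) v.continuous.aestronglyMeasurable (ae_of_all _ fun x => v.norm_coe_le_norm x)
  refine ae_eq_zero_of_forall_integral_continuous hk fun v => ?_
  have hspan : ∀ w ∈ Submodule.span ℂ (Set.range (fourier (T := 2 * Real.pi))),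
      ∫ x, w x * k x ∂μH = 0 := by
    intro w hw
    induction hw using Submodule.span_induction with
    | mem w hw => obtain ⟨n, rfl⟩ := hw; exact h n
    | zero => simp
    | add a b _ _ ha hb =>
      have : ∀ x, (a + b) x * k x = a x * k x + b x * k x := fun x => by
        rw [ContinuousMap.add_apply, add_mul]
      simp_rw [this]
      rw [integral_add (hint a) (hint b), ha, hb, add_zero]
    | smul c a _ ha =>
      have : ∀ x, (c • a) x * k x = c * (a x * k x) := fun x => by
        rw [ContinuousMap.smul_apply, smul_eq_mul, mul_assoc]
      simp_rw [this]
      rw [integral_const_mul, ha, mul_zero]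
  have hv : v ∈ closure (Submodule.span ℂ (Set.range (fourier (T := 2 * Real.pi))) : Set C(𝕋, ℂ)) := by
    rw [← Submodule.topologicalClosure_coe, span_fourier_closure_eq_top]; trivial
  rw [Metric.mem_closure_iff] at hv
  refine norm_le_zero_iff.1 (le_of_forall_pos_le_add fun ε hε => ?_)
  rw [zero_add]
  obtain ⟨w, hw, hvw⟩ := hv (ε / (∫ x, ‖k x‖ ∂μH + 1))
    (div_pos hε (add_pos_of_nonneg_of_pos (integral_nonneg fun _ => norm_nonneg _) one_pos))
  set C := ∫ x, ‖k x‖ ∂μH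
  have hC : 0 ≤ C := integral_nonneg fun _ => norm_nonneg _
  have h1 : ∫ x, v x * k x ∂μH = ∫ x, (v x - w x) * k x ∂μH := by
    simp_rw [sub_mul]
    rw [integral_sub (hint v) (hint w), hspan w hw, sub_zero]
  rw [h1]
  calc ‖∫ x, (v x - w x) * k x ∂μH‖ ≤ ∫ x, (ε / (C + 1)) * ‖k x‖ ∂μH := by
        refine norm_integral_le_of_norm_le (hk.norm.const_mul _) (ae_of_all _ fun x => ?_)
        rw [norm_mul]
        gcongr
        rw [← ContinuousMap.sub_apply]
        refine ((v - w).norm_coe_le_norm x).trans ?_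
        rw [← dist_eq_norm]; exact hvw.le
    _ = ε / (C + 1) * C := integral_const_mul _ _
    _ ≤ ε := by
        rw [div_mul_eq_mul_div, div_le_iff₀ (by positivity)]
        nlinarith

/-- A function which is analytic (with mean zero) and anti-analytic vanishes. -/
theorem ae_eq_zero_of_analytic_of_conj {k : 𝕋 → ℂ} (hk : Integrable k μH)
    (h : ∀ n : ℕ, ∫ x, fourier n x * k x ∂μH = 0)
    (h' : ∀ n : ℕ, ∫ x, fourier n x * conj (k x) ∂μH = 0) : k =ᵐ[μH] 0 := by
  refine ae_eq_zero_of_forall_integral_fourier hk fun n => ?_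
  obtain ⟨m, rfl | rfl⟩ := n.eq_nat_or_neg
  · exact h m
  · have := congrArg conj (h' m)
    rw [← integral_conj, map_zero] at this
    rw [← this]
    congr 1
    ext x
    rw [fourier_neg, map_mul, Complex.conj_conj]

/-- A real analytic function of mean zero vanishes. -/
theorem ae_eq_zero_of_analytic_of_real {k : 𝕋 → ℂ} (hk : Integrable k μH)
    (h : ∀ n : ℕ, ∫ x, fourier n x * k x ∂μH = 0)
    (hreal : ∀ᵐ x ∂μH, conj (k x) = k x) : k =ᵐ[μH] 0 := by
  refine ae_eq_zero_of_analytic_of_conj hk h fun n => ?_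
  rw [← h n]
  refine integral_congr_ae ?_
  filter_upwards [hreal] with x hx
  rw [hx]

/-! ### Jensen's inequality and boundary uniqueness for the Hardy class. -/

theorem fourier_nat_eq_pow (n : ℕ) (x : 𝕋) : fourier (n : ℤ) x = (fourier 1 x : ℂ) ^ n := by
  simp [fourier_apply, AddCircle.toCircle_nsmul]

open Polynomial in
theorem integral_mul_eval_fourier {f : 𝕋 → ℂ} (hf : Integrable f μH)
    (h : ∀ n : ℕ, 1 ≤ n → ∫ x, fourier n x * f x ∂μH = 0) (A : ℂ[X]) :
    ∫ x, A.eval (fourier 1 x) * f x ∂μH = A.eval 0 * ∫ x, f x ∂μH := by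
  have hint : ∀ B : ℂ[X], Integrable (fun x => B.eval (fourier 1 x : ℂ) * f x) μH := fun B => by
    have hc : Continuous fun x : 𝕋 => B.eval (fourier 1 x : ℂ) :=
      B.continuous.comp (fourier 1).continuous
    exact hf.bdd_mul (c := ‖(⟨_, hc⟩ : C(𝕋, ℂ))‖) hc.aestronglyMeasurable
      (ae_of_all _ fun x => (⟨_, hc⟩ : C(𝕋, ℂ)).norm_coe_le_norm x)
  induction A using Polynomial.induction_on' with
  | add p q hp hq =>
    simp only [eval_add, add_mul]
    rw [integral_add (hint p) (hint q), hp, hq]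
  | monomial n a =>
    simp only [eval_monomial, mul_assoc]
    rw [integral_const_mul]
    rcases Nat.eq_zero_or_pos n with rfl | hn
    · simp
    · have := h n hn
      simp_rw [fourier_nat_eq_pow] at this
      rw [this, zero_pow hn.ne']
      simp

open Polynomial in
-- The mean is multiplicative on analytic functions. Exponentials are used because `|exp A| = exp
-- (Re A)`, and `Re A` can approximate any real continuous function. The partial sums of the
-- exponential series are polynomials in `A`, uniformly bounded by `exp M`.
theorem integral_mul_exp_eval_fourier {f : 𝕋 → ℂ} (hf : Integrable f μH)
    (h : ∀ n : ℕ, 1 ≤ n → ∫ x, fourier n x * f x ∂μH = 0) (A : ℂ[X]) :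
    ∫ x, Complex.exp (A.eval (fourier 1 x)) * f x ∂μH = Complex.exp (A.eval 0) * ∫ x, f x ∂μH := by
  set E : ℕ → ℂ[X] := fun N => ∑ k ∈ Finset.range N, C ((k.factorial : ℂ)⁻¹) * A ^ k with hE
  have hlim : ∀ z : ℂ, Tendsto (fun N => (E N).eval z) atTop (𝓝 (Complex.exp (A.eval z))) := by
    intro z
    have h0 := (NormedSpace.exp_series_hasSum_exp' (𝕂 := ℂ) (A.eval z)).tendsto_sum_nat
    rw [← Complex.exp_eq_exp_ℂ] at h0
    refine h0.congr fun N => ?_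
    simp [hE, eval_finsetSum]
  have hc : Continuous fun x : 𝕋 => A.eval (fourier 1 x : ℂ) :=
    A.continuous.comp (fourier 1).continuous
  obtain ⟨M, hM⟩ : ∃ M : ℝ, ∀ x : 𝕋, ‖A.eval (fourier 1 x : ℂ)‖ ≤ M :=
    ⟨_, fun x => (⟨_, hc⟩ : C(𝕋, ℂ)).norm_coe_le_norm x⟩
  have h1 : Tendsto (fun N => ∫ x, (E N).eval (fourier 1 x) * f x ∂μH) atTop
      (𝓝 (∫ x, Complex.exp (A.eval (fourier 1 x)) * f x ∂μH)) := by
    refine tendsto_integral_of_dominated_convergence (fun x => Real.exp M * ‖f x‖) ?_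
      (hf.norm.const_mul _) ?_ ?_
    · intro N
      exact ((E N).continuous.comp (fourier 1).continuous).aestronglyMeasurable.mul hf.1
    · refine fun N => ae_of_all _ fun x => ?_
      rw [norm_mul]
      gcongr
      calc ‖(E N).eval (fourier 1 x : ℂ)‖ ≤ ∑ k ∈ Finset.range N, M ^ k / k.factorial := by
            simp only [hE, eval_finsetSum, eval_mul, eval_C, eval_pow]
            refine norm_sum_le_of_le _ fun k _ => ?_
            rw [norm_mul, norm_pow, norm_inv, Complex.norm_natCast, inv_mul_eq_div]
            gcongr
            exact hM x
        _ ≤ Real.exp M := Real.sum_le_exp_of_nonneg ((norm_nonneg _).trans (hM 0)) N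
    · exact ae_of_all _ fun x => (hlim _).mul_const _
  refine tendsto_nhds_unique h1 ?_
  simp_rw [integral_mul_eval_fourier hf h]
  exact (hlim 0).mul_const _

open Polynomial in
theorem exists_polynomial_of_mem_span_fourier {w : C(𝕋, ℂ)}
    (hw : w ∈ Submodule.span ℂ (Set.range (fourier (T := 2 * Real.pi)))) :
    ∃ A B : ℂ[X], ∀ x, w x = A.eval (fourier 1 x : ℂ) + conj (B.eval (fourier 1 x : ℂ)) := by
  induction hw using Submodule.span_induction with
  | mem w hw =>
    obtain ⟨n, rfl⟩ := hw
    obtain ⟨m, rfl | rfl⟩ := n.eq_nat_or_neg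
    · exact ⟨X ^ m, 0, fun x => by simp [fourier_nat_eq_pow, -fourier_apply]⟩
    · exact ⟨0, X ^ m, fun x => by rw [fourier_neg]; simp [fourier_nat_eq_pow, -fourier_apply]⟩
  | zero => exact ⟨0, 0, fun x => by simp⟩
  | add a b _ _ ha hb =>
    obtain ⟨A, B, h⟩ := ha
    obtain ⟨A', B', h'⟩ := hb
    refine ⟨A + A', B + B', fun x => ?_⟩
    rw [ContinuousMap.add_apply, h, h', eval_add, eval_add, map_add]; ring
  | smul c a _ ha =>
    obtain ⟨A, B, h⟩ := ha
    refine ⟨C c * A, C (conj c) * B, fun x => ?_⟩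
    rw [ContinuousMap.smul_apply, h]; simp [mul_add, -fourier_apply]

theorem exists_polynomial_re_approx (v : C(𝕋, ℝ)) {ε : ℝ} (hε : 0 < ε) :
    ∃ A : Polynomial ℂ, ∀ x, |v x - (A.eval (fourier 1 x : ℂ)).re| < ε := by
  let v' : C(𝕋, ℂ) := ⟨fun x => (v x : ℂ), Complex.continuous_ofReal.comp v.continuous⟩
  have hv : v' ∈ closure (Submodule.span ℂ (Set.range (fourier (T := 2 * Real.pi))) : Set C(𝕋, ℂ)) := by
    rw [← Submodule.topologicalClosure_coe, span_fourier_closure_eq_top]; trivial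
  obtain ⟨w, hw, hvw⟩ := Metric.mem_closure_iff.1 hv ε hε
  obtain ⟨A, B, hAB⟩ := exists_polynomial_of_mem_span_fourier hw
  -- Conjugation does not change real parts, so `A + conj B` and `A + B` have the same real part.
  refine ⟨A + B, fun x => ?_⟩
  have h1 : v x - ((A + B).eval (fourier 1 x : ℂ)).re = ((v' - w) x).re := by
    rw [ContinuousMap.sub_apply, hAB]
    simp [v', -fourier_apply]
  rw [h1]
  refine (Complex.abs_re_le_norm _).trans_lt (((v' - w).norm_coe_le_norm x).trans_lt ?_)
  rwa [← dist_eq_norm]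

/-- A form of Jensen's inequality for functions of the Hardy class. -/
theorem norm_integral_mul_exp_le {f : 𝕋 → ℂ} (hf : Integrable f μH)
    (h : ∀ n : ℕ, 1 ≤ n → ∫ x, fourier n x * f x ∂μH = 0) (v : C(𝕋, ℝ)) :
    ‖∫ x, f x ∂μH‖ * Real.exp (∫ x, v x ∂μH) ≤ ∫ x, Real.exp (v x) * ‖f x‖ ∂μH := by
  have hvint : Integrable v μH := v.continuous.integrable_of_hasCompactSupport
    (HasCompactSupport.of_compactSpace _)
  have hexpint : Integrable (fun x => Real.exp (v x) * ‖f x‖) μH := by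
    have hc : Continuous fun x => Real.exp (v x) := Real.continuous_exp.comp v.continuous
    exact hf.norm.bdd_mul (c := ‖(⟨_, hc⟩ : C(𝕋, ℝ))‖) hc.aestronglyMeasurable
      (ae_of_all _ fun x => (⟨_, hc⟩ : C(𝕋, ℝ)).norm_coe_le_norm x)
  -- With `Re A` within `ε` of `v`, one factor `exp ε` is lost in comparing `∫ v` with `Re A(0)` and
  -- another in comparing `|exp A|` with `exp v`.
  have key : ∀ ε : ℝ, 0 < ε → ‖∫ x, f x ∂μH‖ * Real.exp (∫ x, v x ∂μH) ≤
      Real.exp (2 * ε) * ∫ x, Real.exp (v x) * ‖f x‖ ∂μH := by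
    intro ε hε
    obtain ⟨A, hA⟩ := exists_polynomial_re_approx v hε
    have hc : Continuous fun x : 𝕋 => A.eval (fourier 1 x : ℂ) :=
      A.continuous.comp (fourier 1).continuous
    have hAint : Integrable (fun x : 𝕋 => A.eval (fourier 1 x : ℂ)) μH :=
      hc.integrable_of_hasCompactSupport (HasCompactSupport.of_compactSpace _)
    have h1 := integral_mul_exp_eval_fourier hf h A
    have h2 : ∫ x, A.eval (fourier 1 x : ℂ) ∂μH = A.eval 0 := by
      have := integral_mul_eval_fourier (f := fun _ => 1) (integrable_const _) (fun n hn => by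
        have h3 := fourierCoeff_fourier (T := 2 * Real.pi) (0 : ℤ)
        have h4 := congrFun h3 (-(n : ℤ))
        rw [fourierCoeff] at h4
        simp only [neg_neg, fourier_zero, smul_eq_mul] at h4
        rw [h4, Pi.single_apply, if_neg (by omega)]) A
      simpa using this
    have h5 : ∫ x, v x ∂μH ≤ (A.eval 0).re + ε := by
      have h6 : (A.eval 0).re = ∫ x, (A.eval (fourier 1 x : ℂ)).re ∂μH := by
        rw [← h2]
        exact (integral_re hAint).symm
      have h7 : ∫ x, v x ∂μH ≤ ∫ x, ((A.eval (fourier 1 x : ℂ)).re + ε) ∂μH := by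
        refine integral_mono hvint (hAint.re.add (integrable_const _)) fun x => ?_
        have := (abs_lt.1 (hA x)).2
        simp only
        linarith
      have h8 : ∫ x, ((A.eval (fourier 1 x : ℂ)).re + ε) ∂μH =
          ∫ x, (A.eval (fourier 1 x : ℂ)).re ∂μH + ε := by
        refine (integral_add hAint.re (integrable_const _)).trans ?_
        simp
      linarith
    calc ‖∫ x, f x ∂μH‖ * Real.exp (∫ x, v x ∂μH)
        ≤ ‖∫ x, f x ∂μH‖ * Real.exp ((A.eval 0).re + ε) := by gcongr
      _ = Real.exp ε * ‖Complex.exp (A.eval 0) * ∫ x, f x ∂μH‖ := by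
          rw [norm_mul, Complex.norm_exp, Real.exp_add]; ring
      _ ≤ Real.exp ε * ∫ x, Real.exp ε * (Real.exp (v x) * ‖f x‖) ∂μH := by
          rw [← h1]
          gcongr
          refine norm_integral_le_of_norm_le (hexpint.const_mul _) (ae_of_all _ fun x => ?_)
          rw [norm_mul, Complex.norm_exp, ← mul_assoc, ← Real.exp_add]
          gcongr
          have := (abs_lt.1 (hA x)).1
          linarith
      _ = Real.exp (2 * ε) * ∫ x, Real.exp (v x) * ‖f x‖ ∂μH := by
          rw [integral_const_mul, ← mul_assoc, ← Real.exp_add, ← two_mul ε]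
  have hlim : Tendsto (fun ε : ℝ => Real.exp (2 * ε) * ∫ x, Real.exp (v x) * ‖f x‖ ∂μH)
      (𝓝[>] 0) (𝓝 (Real.exp (2 * 0) * ∫ x, Real.exp (v x) * ‖f x‖ ∂μH)) :=
    ((by fun_prop : Continuous fun ε : ℝ =>
      Real.exp (2 * ε) * ∫ x, Real.exp (v x) * ‖f x‖ ∂μH).tendsto 0).mono_left nhdsWithin_le_nhds
  rw [mul_zero, Real.exp_zero, one_mul] at hlim
  refine ge_of_tendsto hlim ?_
  filter_upwards [self_mem_nhdsWithin] with ε hε using key ε hε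

/-- Jensen's inequality is applied with `v` close to `N` times the indicator of `K`. The right side
stays near `∫ ‖f‖` because `f` vanishes on `K`, while the left side carries the factor `exp (N
μ(K))`, unbounded in `N`. -/
theorem integral_eq_zero_of_vanish {f : 𝕋 → ℂ} (hf : Integrable f μH)
    (h : ∀ n : ℕ, 1 ≤ n → ∫ x, fourier n x * f x ∂μH = 0) {K : Set 𝕋} (hK : IsClosed K)
    (hpos : 0 < (μH).real K) (hfK : ∀ᵐ x ∂μH, x ∈ K → f x = 0) : ∫ x, f x ∂μH = 0 := by
  have key : ∀ N : ℕ, ‖∫ x, f x ∂μH‖ * Real.exp (N * (μH).real K) ≤ ∫ x, ‖f x‖ ∂μH := by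
    intro N
    set v : ℕ → C(𝕋, ℝ) := fun n =>
      ⟨fun x => N * ((thickenedIndicator (Nat.one_div_pos_of_nat (α := ℝ) (n := n)) K x : NNReal) : ℝ),
        continuous_const.mul (NNReal.continuous_coe.comp (thickenedIndicator _ K).continuous)⟩ with hv
    have h1 : Tendsto (fun n => ∫ x, v n x ∂μH) atTop (𝓝 (N * (μH).real K)) := by
      have := (integral_thickenedIndicator_smul_tendsto (k := fun _ => (1 : ℝ))
        (integrable_const _) hK).const_mul (N : ℝ)
      simp only [smul_eq_mul, mul_one, ← integral_const_mul] at this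
      have h3 : ∫ x in K, (N : ℝ) * 1 ∂μH = N * (μH).real K := by simp [mul_comm]
      rw [← h3]
      simpa only [mul_one] using! this
    have h2 : Tendsto (fun n => ∫ x, Real.exp (v n x) * ‖f x‖ ∂μH) atTop (𝓝 (∫ x, ‖f x‖ ∂μH)) := by
      refine tendsto_integral_of_dominated_convergence (fun x => Real.exp N * ‖f x‖) ?_
        (hf.norm.const_mul _) ?_ ?_
      · intro n
        exact (Real.continuous_exp.comp (v n).continuous).aestronglyMeasurable.mul hf.norm.1
      · refine fun n => ae_of_all _ fun x => ?_
        rw [norm_mul, norm_norm, Real.norm_of_nonneg (Real.exp_pos _).le]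
        gcongr
        have := thickenedIndicator_le_one (Nat.one_div_pos_of_nat (α := ℝ) (n := n)) K x
        exact mul_le_of_le_one_right (Nat.cast_nonneg _) (by exact_mod_cast this)
      · filter_upwards [hfK] with x hx
        by_cases hxK : x ∈ K
        · simp [hx hxK]
        · have h3 := tendsto_pi_nhds.1 (thickenedIndicator_tendsto_indicator_closure
            (fun n : ℕ => Nat.one_div_pos_of_nat (α := ℝ) (n := n))
            tendsto_one_div_add_atTop_nhds_zero_nat K) x
          rw [hK.closure_eq, Set.indicator_of_notMem hxK] at h3
          have h4 := (((NNReal.continuous_coe.tendsto _).comp h3).const_mul (N : ℝ))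
          have h5 := ((Real.continuous_exp.tendsto _).comp h4).mul_const ‖f x‖
          simp only [NNReal.coe_zero, mul_zero, Real.exp_zero, one_mul] at h5
          exact h5
    exact le_of_tendsto_of_tendsto' (((Real.continuous_exp.tendsto _).comp h1).const_mul _) h2
      fun n => norm_integral_mul_exp_le hf h (v n)
  by_contra hne
  have hpos' : 0 < ‖∫ x, f x ∂μH‖ := norm_pos_iff.2 hne
  have hlim : Tendsto (fun N : ℕ => ‖∫ x, f x ∂μH‖ * Real.exp (N * (μH).real K)) atTop atTop :=
    Tendsto.const_mul_atTop hpos' (Real.tendsto_exp_atTop.comp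
      (tendsto_natCast_atTop_atTop.atTop_mul_const hpos))
  obtain ⟨N, hN⟩ := (hlim.eventually_gt_atTop (∫ x, ‖f x‖ ∂μH)).exists
  exact absurd (key N) (not_le.2 hN)

/-- Uniqueness theorem: a function of the Hardy class which is not zero almost everywhere is
nonzero almost everywhere. -/
theorem ae_ne_zero_of_analytic {f : 𝕋 → ℂ} (hf : Integrable f μH)
    (h : ∀ n : ℕ, 1 ≤ n → ∫ x, fourier n x * f x ∂μH = 0) (hne : ¬ f =ᵐ[μH] 0) :
    ∀ᵐ x ∂μH, f x ≠ 0 := by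
  by_contra hcon
  apply hne
  obtain ⟨g, hgm, hfg⟩ := hf.1
  have hS : MeasurableSet {x | g x = 0} := hgm.measurable (measurableSet_singleton 0)
  have hS0 : 0 < μH {x | g x = 0} := by
    rw [pos_iff_ne_zero]
    intro h0
    apply hcon
    have : ∀ᵐ x ∂μH, g x ≠ 0 := by rw [ae_iff]; simpa using h0
    filter_upwards [this, hfg] with x hx hx'
    rwa [hx']
  obtain ⟨K, hKS, hK, hKpos⟩ := hS.exists_lt_isCompact hS0
  have hKr : 0 < (μH).real K := ENNReal.toReal_pos hKpos.ne' (measure_ne_top _ _)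
  have hfK : ∀ᵐ x ∂μH, x ∈ K → f x = 0 := by
    filter_upwards [hfg] with x hx hxK
    rw [hx]; exact hKS hxK
  have hint : ∀ n : ℤ, Integrable (fun x => fourier n x * f x) μH := fun n =>
    hf.bdd_mul (c := ‖fourier (T := 2 * Real.pi) n‖) (fourier n).continuous.aestronglyMeasurable
      (ae_of_all _ fun x => (fourier n).norm_coe_le_norm x)
  -- Once the mean vanishes, multiplying by the next negative power of `e^{iθ}` gives again a
  -- function of the Hardy class vanishing on `K`, so the coefficients disappear one after another.
  have hall : ∀ m : ℕ, ∀ n : ℤ, -(m : ℤ) < n → ∫ x, fourier n x * f x ∂μH = 0 := by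
    intro m
    induction m with
    | zero =>
      intro n hn
      obtain ⟨k, rfl⟩ := Int.eq_ofNat_of_zero_le (by simpa using hn.le : 0 ≤ n)
      exact h k (by simp at hn; omega)
    | succ m ih =>
      intro n hn
      rcases eq_or_ne n (-(m : ℤ)) with rfl | hne
      · refine integral_eq_zero_of_vanish (hint _) (fun k hk => ?_) hK.isClosed hKr ?_
        · have := ih (k + -(m : ℤ)) (by omega)
          rw [← this]
          congr 1; ext x
          rw [fourier_add, mul_assoc]
        · filter_upwards [hfK] with x hx hxK
          rw [hx hxK, mul_zero]
      · exact ih n (by push_cast at hn; omega)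
  exact ae_eq_zero_of_forall_integral_fourier hf fun n => hall (n.natAbs + 1) n (by omega)

/-! ### The duality map and its derivative at 1. -/

/-- The duality map `z ↦ |z|^{q-2} z̄`. -/
noncomputable def dualityMap (q : ℝ) (z : ℂ) : ℂ := ((‖z‖ ^ (q - 2) : ℝ) : ℂ) * conj z

theorem dualityMap_mul (q : ℝ) (z w : ℂ) :
    dualityMap q (z * w) = dualityMap q z * dualityMap q w := by
  simp only [dualityMap, norm_mul, Real.mul_rpow (norm_nonneg _) (norm_nonneg _), map_mul,
    Complex.ofReal_mul]
  ring

theorem dualityMap_one (q : ℝ) : dualityMap q 1 = 1 := by simp [dualityMap]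

theorem norm_dualityMap_mul_norm {q : ℝ} (hq : 0 < q) (z : ℂ) : ‖dualityMap q z‖ * ‖z‖ = ‖z‖ ^ q := by
  rcases eq_or_ne z 0 with rfl | hz
  · simp [Real.zero_rpow hq.ne']
  · have h : 0 < ‖z‖ := norm_pos_iff.2 hz
    rw [dualityMap, norm_mul, RCLike.norm_conj, Complex.norm_real,
      Real.norm_of_nonneg (by positivity), mul_assoc, ← sq, ← Real.rpow_natCast,
      ← Real.rpow_add h]
    congr 1; push_cast; ring

/-- Equality fails only at `z = 0` with `q = 1`, where the right side is `0 ^ 0 = 1`. -/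
theorem norm_dualityMap_le {q : ℝ} (hq : 1 ≤ q) (z : ℂ) : ‖dualityMap q z‖ ≤ ‖z‖ ^ (q - 1) := by
  rcases eq_or_ne z 0 with rfl | hz
  · simp only [dualityMap, map_zero, mul_zero, norm_zero]
    exact Real.rpow_nonneg le_rfl _
  · have h : 0 < ‖z‖ := norm_pos_iff.2 hz
    rw [← mul_le_mul_iff_left₀ h, norm_dualityMap_mul_norm (by linarith)]
    nth_rewrite 3 [← Real.rpow_one ‖z‖]
    rw [← Real.rpow_add h]
    simp

theorem dualityMap_mul_self {q : ℝ} (hq : 0 < q) (z : ℂ) :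
    dualityMap q z * z = ((‖z‖ ^ q : ℝ) : ℂ) := by
  rcases eq_or_ne z 0 with rfl | hz
  · simp [Real.zero_rpow hq.ne']
  · have h : 0 < ‖z‖ := norm_pos_iff.2 hz
    rw [dualityMap, mul_assoc, mul_comm (conj z), Complex.mul_conj, Complex.normSq_eq_norm_sq,
      ← Complex.ofReal_mul, ← Real.rpow_natCast, ← Real.rpow_add h]
    congr 2; push_cast; ring

theorem dualityMap_ne_zero {q : ℝ} {z : ℂ} (hz : z ≠ 0) : dualityMap q z ≠ 0 := by
  have h : 0 < ‖z‖ := norm_pos_iff.2 hz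
  exact mul_ne_zero (Complex.ofReal_ne_zero.2 (Real.rpow_pos_of_pos h _).ne')
    ((map_ne_zero _).2 hz)

theorem measurable_dualityMap (q : ℝ) : Measurable (dualityMap q) := by
  unfold dualityMap
  exact (Complex.measurable_ofReal.comp (measurable_norm.pow_const _)).mul
    Complex.continuous_conj.measurable

/-- By multiplicativity, derivatives at 1 suffice: `f + t g = f (1 + t φ)` wherever `f ≠ 0`. -/
theorem hasFDerivAt_norm_one_add_rpow (s : ℝ) :
    HasFDerivAt (fun z : ℂ => ‖1 + z‖ ^ s) (s • Complex.reCLM) 0 := by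
  have h1 : HasFDerivAt (fun z : ℂ => ‖1 + z‖ ^ 2) _ 0 :=
    ((hasFDerivAt_id (𝕜 := ℝ) (0 : ℂ)).const_add 1).norm_sq
  have h2 := h1.rpow_const (p := s / 2) (Or.inl (by simp))
  have h3 : (fun z : ℂ => (‖1 + z‖ ^ 2) ^ (s / 2)) = fun z : ℂ => ‖1 + z‖ ^ s := by
    ext z
    rw [← Real.rpow_natCast, ← Real.rpow_mul (norm_nonneg _)]
    congr 1; push_cast; ring
  rw [h3] at h2
  refine h2.congr_fderiv ?_
  ext z
  simp
  ring

theorem hasFDerivAt_dualityMap_one_add (q : ℝ) :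
    HasFDerivAt (fun z : ℂ => dualityMap q (1 + z))
      ((q - 2) • (Complex.ofRealCLM ∘L Complex.reCLM) + (Complex.conjCLE : ℂ →L[ℝ] ℂ)) 0 := by
  have h1 : HasFDerivAt (fun z : ℂ => ((‖1 + z‖ ^ (q - 2) : ℝ) : ℂ)) _ 0 :=
    Complex.ofRealCLM.hasFDerivAt.comp (0 : ℂ) (hasFDerivAt_norm_one_add_rpow (q - 2))
  have h2 : HasFDerivAt (fun z : ℂ => conj (1 + z)) (Complex.conjCLE : ℂ →L[ℝ] ℂ) 0 :=
    ((Complex.conjCLE : ℂ →L[ℝ] ℂ).hasFDerivAt (x := 1 + 0)).comp (0 : ℂ)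
      ((hasFDerivAt_id (𝕜 := ℝ) (0 : ℂ)).const_add 1)
  refine (h1.mul h2).congr_fderiv ?_
  ext z
  simp [add_comm]

/-! ### Difference quotients and differentiation under the integral. -/

/-- Near 0 the first-order estimate applies; away from 0 the growth bound does, one power of `1 +
‖z‖` being exchanged for `‖z‖`. The result dominates all difference quotients at 0. -/
theorem exists_forall_norm_sub_le {k : ℂ → ℂ} {M s : ℝ} (hs : 0 ≤ s)
    (hk : (fun z => k z - k 0) =O[𝓝 0] (fun z => z)) (hM : ∀ z, ‖k z‖ ≤ M * (1 + ‖z‖) ^ s) :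
    ∃ C, 0 ≤ C ∧ ∀ z, ‖k z - k 0‖ ≤ C * (‖z‖ * (1 + ‖z‖) ^ (max (s - 1) 0)) := by
  obtain ⟨C, hC, h⟩ := hk.exists_pos
  rw [Asymptotics.IsBigOWith, Metric.eventually_nhds_iff] at h
  obtain ⟨δ, hδ, h⟩ := h
  have hM0 : 0 ≤ M := by simpa using (norm_nonneg _).trans (hM 0)
  refine ⟨C + 2 * M * (1 / δ + 1), by positivity, fun z => ?_⟩
  have h1 : 1 ≤ (1 + ‖z‖) ^ (max (s - 1) 0) :=
    Real.one_le_rpow (by linarith [norm_nonneg z]) (le_max_right _ _)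
  rcases lt_or_ge ‖z‖ δ with hz | hz
  · have h2 := h (y := z) (by simpa using hz)
    calc ‖k z - k 0‖ ≤ C * (‖z‖ * 1) := by simpa using h2
      _ ≤ (C + 2 * M * (1 / δ + 1)) * (‖z‖ * (1 + ‖z‖) ^ (max (s - 1) 0)) := by
        gcongr
        exact le_add_of_nonneg_right (by positivity)
  · have hb : 1 ≤ 1 + ‖z‖ := by linarith [norm_nonneg z]
    have h3 : ‖k 0‖ ≤ M * (1 + ‖z‖) ^ s := by
      refine (hM 0).trans ?_
      gcongr
      simp
    have h4 : 1 + ‖z‖ ≤ (1 / δ + 1) * ‖z‖ := by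
      have : 1 ≤ 1 / δ * ‖z‖ := by
        rw [one_div, inv_mul_eq_div]; exact (one_le_div hδ).2 hz
      linarith
    calc ‖k z - k 0‖ ≤ ‖k z‖ + ‖k 0‖ := norm_sub_le _ _
      _ ≤ 2 * M * (1 + ‖z‖) ^ s := by linarith [hM z]
      _ = 2 * M * ((1 + ‖z‖) * (1 + ‖z‖) ^ (s - 1)) := by
        congr 1
        nth_rewrite 2 [← Real.rpow_one (1 + ‖z‖)]
        rw [← Real.rpow_add (by linarith)]
        congr 1; ring
      _ ≤ 2 * M * (((1 / δ + 1) * ‖z‖) * (1 + ‖z‖) ^ (max (s - 1) 0)) := by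
        gcongr
        exact le_max_left _ _
      _ = 2 * M * (1 / δ + 1) * (‖z‖ * (1 + ‖z‖) ^ (max (s - 1) 0)) := by ring
      _ ≤ _ := by
        gcongr
        exact le_add_of_nonneg_left hC.le

/-- Differentiation under the integral sign at a single point. -/
theorem integral_fderiv_eq_zero {α : Type*} [MeasurableSpace α] {μ : Measure α} {k : ℂ → ℂ}
    {D : ℂ →L[ℝ] ℂ} {M s : ℝ} (hs : 0 ≤ s) (hk : HasFDerivAt k D 0) (hkm : Measurable k)
    (hM : ∀ z, ‖k z‖ ≤ M * (1 + ‖z‖) ^ s) {A φ H : α → ℂ} (hA : AEStronglyMeasurable A μ)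
    (hφ : AEStronglyMeasurable φ μ) (hH : AEStronglyMeasurable H μ)
    (hint : Integrable (fun x => ‖A x‖ * (‖φ x‖ * (1 + ‖φ x‖) ^ (max (s - 1) 0)) * ‖H x‖) μ)
    (h0 : ∀ r : ℝ, 0 < r → ∫ x, A x * (k (r * φ x) - k 0) * H x ∂μ = 0) :
    ∫ x, A x * D (φ x) * H x ∂μ = 0 := by
  obtain ⟨C, hC0, hC⟩ := exists_forall_norm_sub_le hs (by simpa using hk.isBigO_sub) hM
  set t : ℕ → ℝ := fun n => 1 / ((n : ℝ) + 1) with ht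
  have htpos : ∀ n, 0 < t n := fun n => Nat.one_div_pos_of_nat
  have ht1 : ∀ n, t n ≤ 1 := fun n => by
    rw [ht]; simp only
    rw [div_le_one (by positivity)]
    have : (0 : ℝ) ≤ n := n.cast_nonneg
    linarith
  have htlim : Tendsto t atTop (𝓝[≠] 0) :=
    tendsto_nhdsWithin_iff.2 ⟨tendsto_one_div_add_atTop_nhds_zero_nat,
      Eventually.of_forall fun n => (htpos n).ne'⟩
  have key : Tendsto (fun n => ∫ x, (t n)⁻¹ • (A x * (k (t n * φ x) - k 0) * H x) ∂μ) atTop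
      (𝓝 (∫ x, A x * D (φ x) * H x ∂μ)) := by
    refine tendsto_integral_of_dominated_convergence _ (fun n => ?_) (hint.const_mul C)
      (fun n => ae_of_all _ fun x => ?_) (ae_of_all _ fun x => ?_)
    · refine AEStronglyMeasurable.const_smul (𝕜 := ℝ) ((hA.mul ?_).mul hH) _
      refine AEStronglyMeasurable.sub ?_ aestronglyMeasurable_const
      exact (hkm.comp_aemeasurable (hφ.aemeasurable.const_mul _)).aestronglyMeasurable
    · rw [norm_smul, norm_inv, Real.norm_of_nonneg (htpos n).le, norm_mul, norm_mul,
        inv_mul_le_iff₀ (htpos n)]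
      have h1 := hC (t n * φ x)
      have h2 : ‖(t n : ℂ) * φ x‖ = t n * ‖φ x‖ := by
        rw [norm_mul, Complex.norm_real, Real.norm_of_nonneg (htpos n).le]
      rw [h2] at h1
      have h3 : C * (t n * ‖φ x‖ * (1 + t n * ‖φ x‖) ^ (max (s - 1) 0)) ≤
          C * (t n * ‖φ x‖ * (1 + ‖φ x‖) ^ (max (s - 1) 0)) := by
        have h4 := (htpos n).le
        gcongr
        exact mul_le_of_le_one_left (norm_nonneg _) (ht1 n)
      calc ‖A x‖ * ‖k (t n * φ x) - k 0‖ * ‖H x‖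
          ≤ ‖A x‖ * (C * (t n * ‖φ x‖ * (1 + ‖φ x‖) ^ (max (s - 1) 0))) * ‖H x‖ := by
            gcongr
            exact h1.trans h3
        _ = _ := by ring
    · have h1 := (hk.hasLineDerivAt (φ x))
      rw [HasLineDerivAt, hasDerivAt_iff_tendsto_slope_zero] at h1
      have h2 := ((h1.comp htlim).const_mul (A x)).mul_const (H x)
      refine h2.congr fun n => ?_
      simp only [Function.comp, zero_add, zero_smul, add_zero, Complex.real_smul]
      ring
  refine tendsto_nhds_unique key ?_
  refine tendsto_const_nhds.congr fun n => ?_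
  rw [integral_smul, h0 (t n) (htpos n), smul_zero]

/-! ### Birkhoff orthogonality in L_q. -/

theorem integrable_norm_rpow_mul_norm_rpow {q x y : ℝ} (hq : 0 < q) (hx : 0 ≤ x) (hy : 0 ≤ y) (hxy : x + y = q)
    {f g : 𝕋 → ℂ} (hf : MemLp f (ENNReal.ofReal q) μH) (hg : MemLp g (ENNReal.ofReal q) μH) :
    Integrable (fun t => ‖f t‖ ^ x * ‖g t‖ ^ y) μH := by
  have hf' := hf.integrable_norm_rpow (by simpa using hq) ENNReal.ofReal_ne_top
  have hg' := hg.integrable_norm_rpow (by simpa using hq) ENNReal.ofReal_ne_top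
  rw [ENNReal.toReal_ofReal hq.le] at hf' hg'
  refine (hf'.add hg').mono' ?_ (ae_of_all _ fun t => ?_)
  · exact ((hf.1.norm.aemeasurable.pow_const _).mul
      (hg.1.norm.aemeasurable.pow_const _)).aestronglyMeasurable
  · rw [Real.norm_of_nonneg (by positivity)]
    set m := max ‖f t‖ ‖g t‖
    have hm : 0 ≤ m := (norm_nonneg _).trans (le_max_left _ _)
    calc ‖f t‖ ^ x * ‖g t‖ ^ y ≤ m ^ x * m ^ y := by
          gcongr
          · exact le_max_left _ _
          · exact le_max_right _ _
      _ = m ^ q := by rw [← Real.rpow_add_of_nonneg hm hx hy, hxy]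
      _ ≤ ‖f t‖ ^ q + ‖g t‖ ^ q := by
        rcases max_cases ‖f t‖ ‖g t‖ with h | h
        · rw [show m = ‖f t‖ from h.1]
          exact le_add_of_nonneg_right (by positivity)
        · rw [show m = ‖g t‖ from h.1]
          exact le_add_of_nonneg_left (by positivity)

/-- Convexity of `‖·‖ ^ q` bounds the slope from above, as `a + t b` lies between `a` and `a + b`,
and from below, as `a` lies between `a + t b` and `a - b`. -/
theorem abs_norm_rpow_slope_le {q : ℝ} (hq : 1 ≤ q) (a b : ℂ) {t : ℝ} (ht : 0 < t) (ht1 : t ≤ 1) :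
    |t⁻¹ * (‖a + t * b‖ ^ q - ‖a‖ ^ q)| ≤ ‖a + b‖ ^ q + ‖a - b‖ ^ q + ‖a‖ ^ q := by
  have hconv : ∀ u v : ℂ, ∀ s : ℝ, 0 ≤ s → s ≤ 1 →
      ‖(1 - s : ℝ) * u + (s : ℝ) * v‖ ^ q ≤ (1 - s) * ‖u‖ ^ q + s * ‖v‖ ^ q := by
    intro u v s hs hs1
    have h1 : ‖(1 - s : ℝ) * u + (s : ℝ) * v‖ ≤ (1 - s) * ‖u‖ + s * ‖v‖ := by
      refine (norm_add_le _ _).trans_eq ?_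
      rw [norm_mul, norm_mul, Complex.norm_real, Complex.norm_real, Real.norm_of_nonneg hs,
        Real.norm_of_nonneg (by linarith)]
    refine (Real.rpow_le_rpow (norm_nonneg _) h1 (by linarith)).trans ?_
    have := (convexOn_rpow hq).2 (norm_nonneg u) (norm_nonneg v) (by linarith : 0 ≤ 1 - s) hs
      (by ring)
    simpa using this
  have h1 := hconv a (a + b) t ht.le ht1
  have e1 : (1 - t : ℝ) * a + (t : ℝ) * (a + b) = a + t * b := by push_cast; ring
  rw [e1] at h1
  have h2 := hconv (a + t * b) (a - b) (t / (1 + t)) (by positivity)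
    (by rw [div_le_one (by positivity)]; linarith)
  have ht' : (1 + t : ℂ) ≠ 0 := by
    have : (1 + t : ℝ) ≠ 0 := by positivity
    exact_mod_cast this
  have e2 : (1 - t / (1 + t) : ℝ) * (a + t * b) + (t / (1 + t) : ℝ) * (a - b) = a := by
    push_cast; field_simp; ring
  rw [e2] at h2
  have h3 : (1 + t) * ‖a‖ ^ q ≤ ‖a + t * b‖ ^ q + t * ‖a - b‖ ^ q := by
    have h4 : (1 + t) * ((1 - t / (1 + t)) * ‖a + t * b‖ ^ q + t / (1 + t) * ‖a - b‖ ^ q) =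
        ‖a + t * b‖ ^ q + t * ‖a - b‖ ^ q := by field_simp; ring
    rw [← h4]; gcongr
  have p1 : 0 ≤ ‖a‖ ^ q := by positivity
  have p2 : 0 ≤ ‖a + b‖ ^ q := by positivity
  have p3 : 0 ≤ ‖a - b‖ ^ q := by positivity
  rw [abs_mul, abs_inv, abs_of_pos ht, inv_mul_le_iff₀ ht, abs_le]
  constructor
  · nlinarith
  · nlinarith

/-- Up to the factor `q`, the right side is the one-sided derivative at `t = 0` of `∫ ‖F + t h‖ ^
q`. The condition `F ≠ 0` a.e. supplies pointwise differentiability when `q = 1`. -/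
theorem integral_dualityMap_mul_re_nonneg {q : ℝ} (hq : 1 ≤ q) {F h : 𝕋 → ℂ}
    (hF : MemLp F (ENNReal.ofReal q) μH) (hh : MemLp h (ENNReal.ofReal q) μH)
    (hF0 : ∀ᵐ x ∂μH, F x ≠ 0)
    (hmin : ∀ t : ℝ, 0 < t → ∫ x, ‖F x‖ ^ q ∂μH ≤ ∫ x, ‖F x + t * h x‖ ^ q ∂μH) :
    0 ≤ (∫ x, dualityMap q (F x) * h x ∂μH).re := by
  have hq0 : 0 < q := by linarith
  have hI : ∀ {G : 𝕋 → ℂ}, MemLp G (ENNReal.ofReal q) μH → Integrable (fun x => ‖G x‖ ^ q) μH := by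
    intro G hG
    have := hG.integrable_norm_rpow (by simpa using hq0) ENNReal.ofReal_ne_top
    rwa [ENNReal.toReal_ofReal hq0.le] at this
  have hJint : Integrable (fun x => dualityMap q (F x) * h x) μH := by
    refine (integrable_norm_rpow_mul_norm_rpow hq0 (x := q - 1) (y := 1) (by linarith) zero_le_one
      (by ring) hF hh).mono' ?_ (ae_of_all _ fun x => ?_)
    · exact ((measurable_dualityMap q).comp_aemeasurable
        hF.1.aemeasurable).aestronglyMeasurable.mul hh.1
    · rw [norm_mul, Real.rpow_one]
      gcongr
      exact norm_dualityMap_le hq _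
  set t : ℕ → ℝ := fun n => 1 / ((n : ℝ) + 1) with ht
  have htpos : ∀ n, 0 < t n := fun n => Nat.one_div_pos_of_nat
  have ht1 : ∀ n, t n ≤ 1 := fun n => by
    rw [ht]; simp only
    rw [div_le_one (by positivity)]
    have : (0 : ℝ) ≤ n := n.cast_nonneg
    linarith
  have htlim : Tendsto t atTop (𝓝[≠] 0) :=
    tendsto_nhdsWithin_iff.2 ⟨tendsto_one_div_add_atTop_nhds_zero_nat,
      Eventually.of_forall fun n => (htpos n).ne'⟩
  have hmemt : ∀ n, MemLp (fun x => F x + t n * h x) (ENNReal.ofReal q) μH := fun n =>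
    hF.add (hh.const_mul _)
  have key : Tendsto (fun n => ∫ x, (t n)⁻¹ * (‖F x + t n * h x‖ ^ q - ‖F x‖ ^ q) ∂μH) atTop
      (𝓝 (∫ x, q * (dualityMap q (F x) * h x).re ∂μH)) := by
    refine tendsto_integral_of_dominated_convergence
      (fun x => ‖F x + h x‖ ^ q + ‖F x - h x‖ ^ q + ‖F x‖ ^ q) (fun n => ?_) ?_
      (fun n => ae_of_all _ fun x => ?_) ?_
    · exact (((hI (hmemt n)).sub (hI hF)).const_mul _).1
    · exact ((hI (hF.add hh)).add (hI (hF.sub hh))).add (hI hF)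
    · exact abs_norm_rpow_slope_le hq _ _ (htpos n) (ht1 n)
    · filter_upwards [hF0] with x hx
      have h1 := (hasFDerivAt_norm_one_add_rpow q).hasLineDerivAt (h x / F x)
      rw [HasLineDerivAt, hasDerivAt_iff_tendsto_slope_zero] at h1
      have h2 := (h1.comp htlim).const_mul (‖F x‖ ^ q)
      have h3 : ‖F x‖ ^ q * (q • Complex.reCLM) (h x / F x) =
          q * (dualityMap q (F x) * h x).re := by
        have : dualityMap q (F x) * h x = ((‖F x‖ ^ q : ℝ) : ℂ) * (h x / F x) := by
          rw [← dualityMap_mul_self hq0]; field_simp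
        rw [this, Complex.re_ofReal_mul]
        simp only [FunLike.coe_smul, Pi.smul_apply, Complex.reCLM_apply, smul_eq_mul]
        ring
      rw [h3] at h2
      refine h2.congr fun n => ?_
      have h4 : F x + t n * h x = F x * (1 + t n * (h x / F x)) := by field_simp
      rw [h4, norm_mul, Real.mul_rpow (norm_nonneg _) (norm_nonneg _)]
      simp only [Function.comp, zero_add, zero_smul, add_zero, Complex.real_smul, norm_one,
        Real.one_rpow, smul_eq_mul]
      ring
  have hnn : 0 ≤ ∫ x, q * (dualityMap q (F x) * h x).re ∂μH := by
    refine ge_of_tendsto' key fun n => ?_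
    rw [integral_const_mul, integral_sub (hI (hmemt n)) (hI hF)]
    exact mul_nonneg (inv_nonneg.2 (htpos n).le) (sub_nonneg.2 (hmin _ (htpos n)))
  rw [integral_const_mul] at hnn
  have h5 : ∫ x, (dualityMap q (F x) * h x).re ∂μH = (∫ x, dualityMap q (F x) * h x ∂μH).re :=
    integral_re hJint
  rw [← h5]
  exact nonneg_of_mul_nonneg_right hnn hq0

/-- Birkhoff orthogonality in `L_q` in terms of the duality map. -/
theorem integral_dualityMap_mul_eq_zero {q : ℝ} (hq : 1 ≤ q) {F h : 𝕋 → ℂ}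
    (hF : MemLp F (ENNReal.ofReal q) μH) (hh : MemLp h (ENNReal.ofReal q) μH)
    (hF0 : ∀ᵐ x ∂μH, F x ≠ 0)
    (hmin : ∀ t : ℂ, ∫ x, ‖F x‖ ^ q ∂μH ≤ ∫ x, ‖F x + t * h x‖ ^ q ∂μH) :
    ∫ x, dualityMap q (F x) * h x ∂μH = 0 := by
  have key : ∀ c : ℂ, 0 ≤ (c * ∫ x, dualityMap q (F x) * h x ∂μH).re := by
    intro c
    have := integral_dualityMap_mul_re_nonneg hq hF (hh.const_mul c) hF0 (fun t _ => by
      have := hmin (t * c)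
      simpa only [mul_assoc] using this)
    rw [← integral_const_mul]
    have h2 : ∀ x, c * (dualityMap q (F x) * h x) = dualityMap q (F x) * (c * h x) := fun x => by
      ring
    simp_rw [h2]
    exact this
  set I := ∫ x, dualityMap q (F x) * h x ∂μH
  -- This multiple of `h` turns the inequality into `-|I|² ≥ 0`.
  have h1 := key (-conj I)
  rw [neg_mul, mul_comm, Complex.mul_conj, Complex.neg_re, Complex.ofReal_re] at h1
  exact Complex.normSq_eq_zero.1 (le_antisymm (by linarith) (Complex.normSq_nonneg _))

/-! ### Models of contractive projections, and good functions. -/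

/-- The range `V` of a contractive projection `P` on a Hardy space, as a space of functions;
`R n y` stands for `P (e_n y)`. -/
structure IsContractiveModel (q : ℝ) (V : Submodule ℂ (𝕋 → ℂ))
    (R : ℕ → (𝕋 → ℂ) → (𝕋 → ℂ)) : Prop where
  one_le : 1 ≤ q
  memLp : ∀ y ∈ V, MemLp y (ENNReal.ofReal q) μH
  ae_ne_zero : ∀ y ∈ V, y ≠ 0 → ∀ᵐ x ∂μH, y x ≠ 0
  map_mem : ∀ n, ∀ y ∈ V, R n y ∈ V
  orth : ∀ n : ℕ, ∀ y ∈ V, ∀ F ∈ V, F ≠ 0 →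
    ∫ x, dualityMap q (F x) * (fourier n x * y x - R n y x) ∂μH = 0

/-- `f, g` is a basis of `V`. -/
structure IsPair (V : Submodule ℂ (𝕋 → ℂ)) (f g : 𝕋 → ℂ) : Prop where
  left_mem : f ∈ V
  right_mem : g ∈ V
  span : ∀ y ∈ V, ∃ a b : ℂ, y = a • f + b • g
  indep : ∀ a b : ℂ, a • f + b • g = 0 → a = 0 ∧ b = 0

/-- `K` defines a functional on `V` and its shifts which factors through the projection. -/
structure IsGood (V : Submodule ℂ (𝕋 → ℂ)) (R : ℕ → (𝕋 → ℂ) → (𝕋 → ℂ)) (K : 𝕋 → ℂ) : Prop where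
  integrable : ∀ y ∈ V, Integrable (fun x => K x * y x) μH
  factor : ∀ n : ℕ, ∀ y ∈ V, ∫ x, K x * (fourier n x * y x - R n y x) ∂μH = 0

theorem integrable_fourier_mul {k : 𝕋 → ℂ} (hk : Integrable k μH) (n : ℤ) :
    Integrable (fun x => fourier n x * k x) μH :=
  hk.bdd_mul (c := ‖fourier (T := 2 * Real.pi) n‖) (fourier n).continuous.aestronglyMeasurable
    (ae_of_all _ fun x => (fourier n).norm_coe_le_norm x)

theorem norm_fourier_apply (n : ℤ) (x : 𝕋) : ‖(fourier n x : ℂ)‖ = 1 := by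
  rw [fourier_apply]; exact Circle.norm_coe _

variable {q : ℝ} {V : Submodule ℂ (𝕋 → ℂ)} {R : ℕ → (𝕋 → ℂ) → (𝕋 → ℂ)}

namespace IsPair

variable {f g : 𝕋 → ℂ}

theorem left_ne_zero (h : IsPair V f g) : f ≠ 0 := fun h0 => by
  have := (h.indep 1 0 (by simp [h0])).1
  exact one_ne_zero this

theorem add_smul_ne_zero (h : IsPair V f g) (c : ℂ) : f + c • g ≠ 0 := fun h0 => by
  have := (h.indep 1 c (by simpa using h0)).1
  exact one_ne_zero this

theorem smul_sub_smul (h : IsPair V f g) {a : ℂ} (ha : a ≠ 0) (b : ℂ) :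
    IsPair V f (a • g - b • f) where
  left_mem := h.left_mem
  right_mem := V.sub_mem (V.smul_mem _ h.right_mem) (V.smul_mem _ h.left_mem)
  span y hy := by
    obtain ⟨c, d, rfl⟩ := h.span y hy
    refine ⟨c + d * a⁻¹ * b, d * a⁻¹, ?_⟩
    ext x
    simp only [Pi.add_apply, Pi.smul_apply, Pi.sub_apply, smul_eq_mul]
    field_simp
    ring
  indep c d hcd := by
    have h1 := h.indep (c - d * b) (d * a) (by
      rw [← hcd]; ext x
      simp only [Pi.add_apply, Pi.smul_apply, Pi.sub_apply, smul_eq_mul]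
      ring)
    have hd : d = 0 := (mul_eq_zero.1 h1.2).resolve_right ha
    refine ⟨?_, hd⟩
    simpa [hd] using h1.1

theorem add_smul (h : IsPair V f g) (t : ℂ) : IsPair V (f + t • g) g where
  left_mem := V.add_mem h.left_mem (V.smul_mem _ h.right_mem)
  right_mem := h.right_mem
  span y hy := by
    obtain ⟨c, d, rfl⟩ := h.span y hy
    refine ⟨c, d - c * t, ?_⟩
    ext x
    simp only [Pi.add_apply, Pi.smul_apply, smul_eq_mul]
    ring
  indep c d hcd := by
    have h1 := h.indep c (d + c * t) (by
      rw [← hcd]; ext x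
      simp only [Pi.add_apply, Pi.smul_apply, smul_eq_mul]
      ring)
    refine ⟨h1.1, ?_⟩
    simpa [h1.1] using h1.2

theorem swap (h : IsPair V f g) : IsPair V g f where
  left_mem := h.right_mem
  right_mem := h.left_mem
  span y hy := by
    obtain ⟨c, d, rfl⟩ := h.span y hy
    exact ⟨d, c, add_comm _ _⟩
  indep c d hcd := (h.indep d c (by rw [add_comm, hcd])).symm

end IsPair

namespace IsGood

variable {f g K K' : 𝕋 → ℂ}

theorem add (hR : ∀ n, ∀ y ∈ V, R n y ∈ V) (h : IsGood V R K) (h' : IsGood V R K') :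
    IsGood V R (fun x => K x + K' x) where
  integrable y hy := by
    simp_rw [add_mul]
    exact (h.integrable y hy).add (h'.integrable y hy)
  factor n y hy := by
    have hi : ∀ {K : 𝕋 → ℂ}, IsGood V R K →
        Integrable (fun x => K x * (fourier n x * y x - R n y x)) μH := by
      intro K h
      have h1 := (integrable_fourier_mul (h.integrable y hy) n).sub (h.integrable _ (hR n y hy))
      refine h1.congr (ae_of_all _ fun x => ?_)
      simp only [Pi.sub_apply]; ring
    simp_rw [add_mul]
    rw [integral_add (hi h) (hi h'), h.factor n y hy, h'.factor n y hy, add_zero]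

theorem const_mul (h : IsGood V R K) (c : ℂ) : IsGood V R (fun x => c * K x) where
  integrable y hy := by
    simp_rw [mul_assoc]
    exact (h.integrable y hy).const_mul c
  factor n y hy := by
    simp_rw [mul_assoc]
    rw [integral_const_mul, h.factor n y hy, mul_zero]

theorem sum {ι : Type*} (hR : ∀ n, ∀ y ∈ V, R n y ∈ V) (s : Finset ι) {K : ι → 𝕋 → ℂ}
    (h : ∀ i ∈ s, IsGood V R (K i)) (c : ι → ℂ) :
    IsGood V R (fun x => ∑ i ∈ s, c i * K i x) := by
  classical
  induction s using Finset.induction_on with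
  | empty => exact ⟨fun y _ => by simp, fun n y _ => by simp⟩
  | insert a s ha ih =>
    simp_rw [Finset.sum_insert ha]
    exact add hR ((h a (Finset.mem_insert_self _ _)).const_mul (c a))
      (ih fun i hi => h i (Finset.mem_insert_of_mem hi))

theorem congr (h : IsGood V R K) (hK : K =ᵐ[μH] K') : IsGood V R K' where
  integrable y hy := (h.integrable y hy).congr (by filter_upwards [hK] with x hx; rw [hx])
  factor n y hy := by
    rw [← h.factor n y hy]
    refine integral_congr_ae ?_
    filter_upwards [hK] with x hx
    rw [hx]

/-- If a good `K` annihilates `V`, then it annihilates all shifts of `V`. -/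
theorem integral_fourier_mul (hR : ∀ n, ∀ y ∈ V, R n y ∈ V) (hp : IsPair V f g)
    (h : IsGood V R K) (hf : ∫ x, K x * f x ∂μH = 0) (hg : ∫ x, K x * g x ∂μH = 0)
    {y : 𝕋 → ℂ} (hy : y ∈ V) (n : ℕ) : ∫ x, fourier n x * (K x * y x) ∂μH = 0 := by
  have hV : ∀ y ∈ V, ∫ x, K x * y x ∂μH = 0 := by
    intro y hy
    obtain ⟨a, b, rfl⟩ := hp.span y hy
    have h1 : ∀ x, K x * (a • f + b • g) x = a * (K x * f x) + b * (K x * g x) := fun x => by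
      simp only [Pi.add_apply, Pi.smul_apply, smul_eq_mul]; ring
    simp_rw [h1]
    rw [integral_add ((h.integrable f hp.left_mem).const_mul a)
      ((h.integrable g hp.right_mem).const_mul b), integral_const_mul, integral_const_mul, hf, hg]
    simp
  have h1 := h.factor n y hy
  have h2 : ∀ x, K x * (fourier n x * y x - R n y x) =
      fourier n x * (K x * y x) - K x * R n y x := fun x => by ring
  simp_rw [h2] at h1
  rwa [integral_sub (integrable_fourier_mul (h.integrable y hy) n)
    (h.integrable _ (hR n y hy)), hV _ (hR n y hy), sub_zero] at h1

/-- The tool that converts finitely many linear conditions on `K` into a pointwise identity: `K y`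
is analytic of mean zero, and a real function of this kind is 0. -/
theorem ae_eq_zero_of_real (hR : ∀ n, ∀ y ∈ V, R n y ∈ V) (hp : IsPair V f g)
    (h : IsGood V R K) (hf : ∫ x, K x * f x ∂μH = 0) (hg : ∫ x, K x * g x ∂μH = 0)
    {y : 𝕋 → ℂ} (hy : y ∈ V) (hreal : ∀ᵐ x ∂μH, conj (K x * y x) = K x * y x) :
    ∀ᵐ x ∂μH, K x * y x = 0 :=
  ae_eq_zero_of_analytic_of_real (h.integrable y hy)
    (h.integral_fourier_mul hR hp hf hg hy) hreal

end IsGood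

/-! ### Good functions from variations of the duality map. -/

/-- Integrability condition on `φ = g / f` with respect to the density `|f|^q`. -/
def HasMoment (q : ℝ) (f g : 𝕋 → ℂ) (j : ℝ) : Prop :=
  Integrable (fun x => ‖f x‖ ^ q * (1 + ‖g x / f x‖) ^ (max q j)) μH

namespace IsContractiveModel

variable {f g : 𝕋 → ℂ}

/-- Moments up to order `q` are automatic, since `|f| (1 + |g/f|) = |f| + |g|` is in `L_q`. -/
theorem hasMoment_of_le (hV : IsContractiveModel q V R) (hp : IsPair V f g) {j : ℝ} (hj : j ≤ q) :
    HasMoment q f g j := by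
  have hq : 0 < q := by linarith [hV.one_le]
  have hf := hV.memLp f hp.left_mem
  have hg := hV.memLp g hp.right_mem
  have h1 : MemLp (fun x => ‖f x‖ + ‖g x‖) (ENNReal.ofReal q) μH := hf.norm.add hg.norm
  have h2 := h1.integrable_norm_rpow (by simpa using hq) ENNReal.ofReal_ne_top
  rw [ENNReal.toReal_ofReal hq.le] at h2
  refine h2.congr ?_
  filter_upwards [hV.ae_ne_zero f hp.left_mem hp.left_ne_zero] with x hx
  rw [max_eq_left hj, ← Real.mul_rpow (norm_nonneg _) (by positivity), norm_div,
    Real.norm_of_nonneg (by positivity)]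
  congr 1
  have : ‖f x‖ ≠ 0 := norm_ne_zero_iff.2 hx
  field_simp

theorem aestronglyMeasurable_div (hV : IsContractiveModel q V R) (hp : IsPair V f g) :
    AEStronglyMeasurable (fun x => g x / f x) μH :=
  ((hV.memLp g hp.right_mem).1.aemeasurable.div
    (hV.memLp f hp.left_mem).1.aemeasurable).aestronglyMeasurable

theorem aestronglyMeasurable_dualityMap (hV : IsContractiveModel q V R) {F : 𝕋 → ℂ} (hF : F ∈ V) :
    AEStronglyMeasurable (fun x => dualityMap q (F x)) μH :=
  ((measurable_dualityMap q).comp_aemeasurable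
    (hV.memLp F hF).1.aemeasurable).aestronglyMeasurable

/-- Elements of `V` are bounded by a constant times `|f| (1 + |φ|)`. The factor `|f|` completes
`|J(f)|` to `|f|^q`, and the other factor costs one moment, whence `m + 1`. -/
theorem integrable_moment (hV : IsContractiveModel q V R) (hp : IsPair V f g) {j m : ℝ}
    (hW : HasMoment q f g j) (hm : m + 1 ≤ max q j) {y : 𝕋 → ℂ} (hy : y ∈ V) :
    Integrable (fun x => ‖dualityMap q (f x)‖ * (1 + ‖g x / f x‖) ^ m * ‖y x‖) μH := by
  have hq : 0 < q := by linarith [hV.one_le]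
  obtain ⟨a, b, rfl⟩ := hp.span y hy
  refine (hW.const_mul (‖a‖ + ‖b‖)).mono' ?_ ?_
  · refine AEStronglyMeasurable.mul ((hV.aestronglyMeasurable_dualityMap hp.left_mem).norm.mul ?_)
      (hV.memLp _ hy).1.norm
    exact (((hV.aestronglyMeasurable_div hp).norm.aemeasurable.const_add 1).pow_const
      _).aestronglyMeasurable
  · filter_upwards [hV.ae_ne_zero f hp.left_mem hp.left_ne_zero] with x hx
    have hb : 1 ≤ 1 + ‖g x / f x‖ := by linarith [norm_nonneg (g x / f x)]
    have h1 : ‖(a • f + b • g) x‖ ≤ (‖a‖ + ‖b‖) * (‖f x‖ * (1 + ‖g x / f x‖)) := by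
      have h2 : (a • f + b • g) x = f x * (a + b * (g x / f x)) := by
        simp only [Pi.add_apply, Pi.smul_apply, smul_eq_mul]; field_simp
      rw [h2, norm_mul]
      have h3 : ‖a + b * (g x / f x)‖ ≤ (‖a‖ + ‖b‖) * (1 + ‖g x / f x‖) := by
        refine (norm_add_le _ _).trans ?_
        rw [norm_mul]
        nlinarith [norm_nonneg a, norm_nonneg b, norm_nonneg (g x / f x),
          mul_nonneg (norm_nonneg a) (norm_nonneg (g x / f x))]
      calc ‖f x‖ * ‖a + b * (g x / f x)‖ ≤ ‖f x‖ * ((‖a‖ + ‖b‖) * (1 + ‖g x / f x‖)) := by gcongr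
        _ = _ := by ring
    rw [Real.norm_of_nonneg (by positivity)]
    calc ‖dualityMap q (f x)‖ * (1 + ‖g x / f x‖) ^ m * ‖(a • f + b • g) x‖
        ≤ ‖dualityMap q (f x)‖ * (1 + ‖g x / f x‖) ^ m *
          ((‖a‖ + ‖b‖) * (‖f x‖ * (1 + ‖g x / f x‖))) := by gcongr
      _ = (‖a‖ + ‖b‖) * ((‖dualityMap q (f x)‖ * ‖f x‖) *
          ((1 + ‖g x / f x‖) ^ m * (1 + ‖g x / f x‖))) := by ring
      _ = (‖a‖ + ‖b‖) * (‖f x‖ ^ q * (1 + ‖g x / f x‖) ^ (m + 1)) := by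
        rw [norm_dualityMap_mul_norm hq, Real.rpow_add (by linarith), Real.rpow_one]
      _ ≤ _ := by gcongr

theorem isGood_of_norm_le (hV : IsContractiveModel q V R) (hp : IsPair V f g) {j m C : ℝ}
    (hW : HasMoment q f g j) (hm : m + 1 ≤ max q j) {ψ : 𝕋 → ℂ} (hψ : AEStronglyMeasurable ψ μH)
    (hle : ∀ x, ‖ψ x‖ ≤ C * (1 + ‖g x / f x‖) ^ m)
    (h0 : ∀ n : ℕ, ∀ y ∈ V,
      ∫ x, dualityMap q (f x) * ψ x * (fourier n x * y x - R n y x) ∂μH = 0) :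
    IsGood V R (fun x => dualityMap q (f x) * ψ x) where
  integrable y hy := by
    refine ((hV.integrable_moment hp hW hm hy).const_mul C).mono'
      (((hV.aestronglyMeasurable_dualityMap hp.left_mem).mul hψ).mul (hV.memLp y hy).1)
      (ae_of_all _ fun x => ?_)
    rw [norm_mul, norm_mul]
    calc ‖dualityMap q (f x)‖ * ‖ψ x‖ * ‖y x‖
        ≤ ‖dualityMap q (f x)‖ * (C * (1 + ‖g x / f x‖) ^ m) * ‖y x‖ := by
          gcongr; exact hle x
      _ = _ := by ring
  factor n y hy := h0 n y hy

theorem isGood_dualityMap (hV : IsContractiveModel q V R) (hp : IsPair V f g) :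
    IsGood V R (fun x => dualityMap q (f x)) := by
  have := hV.isGood_of_norm_le hp (j := q) (m := 0) (C := 1) (ψ := fun _ => 1)
    (hV.hasMoment_of_le hp le_rfl) (by simpa using hV.one_le) aestronglyMeasurable_const
    (fun x => by simp) (fun n y hy => by
      simpa using hV.orth n y hy f hp.left_mem hp.left_ne_zero)
  simpa using this

theorem integrable_moment_shift (hV : IsContractiveModel q V R) (hp : IsPair V f g) {j m : ℝ}
    (hW : HasMoment q f g j) (hm : m + 1 ≤ max q j) {y : 𝕋 → ℂ} (hy : y ∈ V) (n : ℕ) :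
    Integrable (fun x => ‖dualityMap q (f x)‖ * (1 + ‖g x / f x‖) ^ m *
      ‖fourier n x * y x - R n y x‖) μH := by
  refine ((hV.integrable_moment hp hW hm hy).add
    (hV.integrable_moment hp hW hm (hV.map_mem n y hy))).mono' ?_ (ae_of_all _ fun x => ?_)
  · refine AEStronglyMeasurable.mul ((hV.aestronglyMeasurable_dualityMap hp.left_mem).norm.mul ?_)
      (((fourier n).continuous.aestronglyMeasurable.mul (hV.memLp _ hy).1).sub
        (hV.memLp _ (hV.map_mem n y hy)).1).norm
    exact (((hV.aestronglyMeasurable_div hp).norm.aemeasurable.const_add 1).pow_const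
      _).aestronglyMeasurable
  · rw [Real.norm_of_nonneg (by positivity), Pi.add_apply, ← mul_add]
    gcongr
    refine (norm_sub_le _ _).trans_eq ?_
    rw [norm_mul, norm_fourier_apply, one_mul]

/-- First variation of the duality map along the range of a contractive projection. -/
theorem isGood_first_variation (hV : IsContractiveModel q V R) (hp : IsPair V f g)
    (hW : HasMoment q f g 2) :
    IsGood V R (fun x => dualityMap q (f x) * conj (g x / f x)) ∧
    IsGood V R (fun x => dualityMap q (f x) * ((q - 2) * (g x / f x))) := by
  have hq1 := hV.one_le
  have hq : 0 < q := by linarith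
  have hφ := hV.aestronglyMeasurable_div hp
  -- This is the derivative of `J(f + r ζ g) = J(f) J(1 + r ζ φ)` in real `r` at 0. Each difference
  -- quotient is good because `f + r ζ g` lies in `V`.
  have key : ∀ ζ : ℂ, ‖ζ‖ = 1 → IsGood V R (fun x => dualityMap q (f x) *
      ((q - 2) * ((ζ * (g x / f x)).re : ℂ) + conj (ζ * (g x / f x)))) := by
    intro ζ hζ
    refine hV.isGood_of_norm_le hp (m := 1) (C := |q - 2| + 1) hW
      (by norm_num) ?_ ?_ ?_
    · exact (((Complex.measurable_ofReal.comp Complex.measurable_re).comp_aemeasurable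
        (hφ.const_mul ζ).aemeasurable).const_mul _).aestronglyMeasurable.add
        (Complex.continuous_conj.comp_aestronglyMeasurable (hφ.const_mul ζ))
    · intro x
      have h1 : ‖ζ * (g x / f x)‖ = ‖g x / f x‖ := by rw [norm_mul, hζ, one_mul]
      rw [Real.rpow_one]
      refine (norm_add_le _ _).trans ?_
      rw [norm_mul, RCLike.norm_conj, h1, Complex.norm_real]
      have h2 : ‖(q - 2 : ℂ)‖ = |q - 2| := by
        rw [← Real.norm_eq_abs, ← Complex.norm_real]; push_cast; rfl
      have h3 : ‖(ζ * (g x / f x)).re‖ ≤ ‖g x / f x‖ := (Complex.abs_re_le_norm _).trans_eq h1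
      rw [h2]
      nlinarith [abs_nonneg (q - 2), norm_nonneg (g x / f x)]
    · intro n y hy
      have hHm : AEStronglyMeasurable (fun x => fourier n x * y x - R n y x) μH :=
        ((fourier n).continuous.aestronglyMeasurable.mul (hV.memLp _ hy).1).sub
          (hV.memLp _ (hV.map_mem n y hy)).1
      have h1 := integral_fderiv_eq_zero (μ := μH) (k := fun z => dualityMap q (1 + z)) (M := 1)
        (s := q - 1) (by linarith) (hasFDerivAt_dualityMap_one_add q)
        ((measurable_dualityMap q).comp (measurable_const_add 1)) (fun z => by
          rw [one_mul]
          refine (norm_dualityMap_le hq1 _).trans ?_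
          refine Real.rpow_le_rpow (norm_nonneg _) ?_ (by linarith)
          simpa using norm_add_le 1 z)
        (A := fun x => dualityMap q (f x)) (φ := fun x => ζ * (g x / f x))
        (H := fun x => fourier n x * y x - R n y x)
        (hV.aestronglyMeasurable_dualityMap hp.left_mem) (hφ.const_mul ζ) hHm ?_ ?_
      · simpa using h1
      · refine (hV.integrable_moment_shift hp hW (m := max (q - 2) 0 + 1) ?_ hy n).mono' ?_ ?_
        · rw [← max_add_add_right, ← max_add_add_right]
          refine max_le_max ?_ ?_ <;> linarith
        · refine AEStronglyMeasurable.mul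
            ((hV.aestronglyMeasurable_dualityMap hp.left_mem).norm.mul ?_) hHm.norm
          exact (hφ.const_mul ζ).norm.mul
            ((((hφ.const_mul ζ).norm.aemeasurable.const_add 1).pow_const _).aestronglyMeasurable)
        · refine ae_of_all _ fun x => ?_
          rw [Real.norm_of_nonneg (by positivity)]
          have h1 : ‖ζ * (g x / f x)‖ = ‖g x / f x‖ := by rw [norm_mul, hζ, one_mul]
          rw [h1, Real.rpow_add (by positivity), Real.rpow_one,
            show q - 1 - 1 = q - 2 by ring, mul_comm ‖g x / f x‖]
          gcongr
          linarith
      · intro r hr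
        have hFmem : f + (r * ζ) • g ∈ V := (hp.add_smul (r * ζ)).left_mem
        have hint : ∀ {F : 𝕋 → ℂ}, F ∈ V → F ≠ 0 → Integrable (fun x => dualityMap q (F x) *
            (fourier n x * y x - R n y x)) μH := by
          intro F hF hF0
          have hmem : MemLp (fun x => fourier n x * y x - R n y x) (ENNReal.ofReal q) μH := by
            refine MemLp.sub ?_ (hV.memLp _ (hV.map_mem n y hy))
            refine (hV.memLp y hy).of_le
              ((fourier n).continuous.aestronglyMeasurable.mul (hV.memLp _ hy).1)
              (ae_of_all _ fun x => ?_)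
            rw [norm_mul, norm_fourier_apply, one_mul]
          refine (integrable_norm_rpow_mul_norm_rpow hq (x := q - 1) (y := 1) (by linarith)
            zero_le_one (by ring) (hV.memLp F hF) hmem).mono'
            ((hV.aestronglyMeasurable_dualityMap hF).mul hHm) (ae_of_all _ fun x => ?_)
          rw [norm_mul, Real.rpow_one]
          gcongr
          exact norm_dualityMap_le hq1 _
        have h2 := hV.orth n y hy _ hFmem (hp.add_smul_ne_zero _)
        have h3 := hV.orth n y hy f hp.left_mem hp.left_ne_zero
        have h4 := integral_sub (hint hFmem (hp.add_smul_ne_zero _))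
          (hint hp.left_mem hp.left_ne_zero)
        rw [h2, h3, sub_zero] at h4
        refine Eq.trans ?_ h4
        refine integral_congr_ae ?_
        filter_upwards [hV.ae_ne_zero f hp.left_mem hp.left_ne_zero] with x hx
        have h5 : (f + (r * ζ) • g) x = f x * (1 + r * (ζ * (g x / f x))) := by
          simp only [Pi.add_apply, Pi.smul_apply, smul_eq_mul]; field_simp
        rw [h5, dualityMap_mul, add_zero, dualityMap_one]
        ring
  -- The directions `1` and `i` separate the parts linear and antilinear in `φ`: `k1 + i kI` yields
  -- `q φ̄`, and `k1 - i kI` yields `(q - 2) φ`.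
  have k1 := key 1 (by simp)
  have kI := key Complex.I (by simp)
  have hre : ∀ z : ℂ, ((z.re : ℝ) : ℂ) = (z + conj z) / 2 := Complex.re_eq_add_conj
  constructor
  · refine ((k1.add hV.map_mem (kI.const_mul Complex.I)).const_mul (1 / q)).congr
      (ae_of_all _ fun x => ?_)
    have hq' : (q : ℂ) ≠ 0 := by exact_mod_cast hq.ne'
    simp only [hre, map_mul, Complex.conj_I, one_mul]
    field_simp
    ring_nf
    simp only [Complex.I_sq]
    ring
  · refine (k1.add hV.map_mem (kI.const_mul (-Complex.I))).congr (ae_of_all _ fun x => ?_)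
    simp only [hre, map_mul, Complex.conj_I, one_mul]
    ring_nf
    simp only [Complex.I_sq]
    ring

/-- Second variation of the duality map along the range of a contractive projection. -/
theorem isGood_second_variation (hV : IsContractiveModel q V R) (hq2 : 2 < q) (hp : IsPair V f g)
    (hW : HasMoment q f g 3) :
    IsGood V R (fun x => dualityMap q (f x) * (conj (g x / f x) * (g x / f x))) ∧
    IsGood V R (fun x => dualityMap q (f x) * (conj (g x / f x) * conj (g x / f x))) := by
  have hq1 := hV.one_le
  have hq : 0 < q := by linarith
  have hφ := hV.aestronglyMeasurable_div hp
  have hcφ := Complex.continuous_conj.comp_aestronglyMeasurable hφ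
  -- The first variation at the pair `f + t g, g` is `J(f) φ̄ |1 + t φ|^(q-2)`, because the
  -- conjugate of `1 + t φ` cancels. Only this power of the modulus remains to be differentiated,
  -- and its growth exponent `q - 2` is nonnegative here.
  have key : ∀ ζ : ℂ, ‖ζ‖ = 1 → IsGood V R (fun x => dualityMap q (f x) *
      (conj (g x / f x) * ((q - 2) * ((ζ * (g x / f x)).re : ℂ)))) := by
    intro ζ hζ
    refine hV.isGood_of_norm_le hp (m := 2) (C := |q - 2|) hW (by norm_num) ?_ ?_ ?_
    · exact hcφ.mul (((Complex.measurable_ofReal.comp Complex.measurable_re).comp_aemeasurable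
        (hφ.const_mul ζ).aemeasurable).const_mul _).aestronglyMeasurable
    · intro x
      have h1 : ‖ζ * (g x / f x)‖ = ‖g x / f x‖ := by rw [norm_mul, hζ, one_mul]
      rw [norm_mul, norm_mul, RCLike.norm_conj, Complex.norm_real]
      have h2 : ‖(q - 2 : ℂ)‖ = |q - 2| := by
        rw [← Real.norm_eq_abs, ← Complex.norm_real]; push_cast; rfl
      have h3 : ‖(ζ * (g x / f x)).re‖ ≤ ‖g x / f x‖ := (Complex.abs_re_le_norm _).trans_eq h1
      rw [h2, show (1 + ‖g x / f x‖) ^ (2 : ℝ) = (1 + ‖g x / f x‖) ^ 2 by norm_cast]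
      calc ‖g x / f x‖ * (|q - 2| * ‖(ζ * (g x / f x)).re‖)
          ≤ ‖g x / f x‖ * (|q - 2| * ‖g x / f x‖) := by gcongr
        _ = |q - 2| * ‖g x / f x‖ ^ 2 := by ring
        _ ≤ _ := by gcongr; linarith
    · intro n y hy
      have hHm : AEStronglyMeasurable (fun x => fourier n x * y x - R n y x) μH :=
        ((fourier n).continuous.aestronglyMeasurable.mul (hV.memLp _ hy).1).sub
          (hV.memLp _ (hV.map_mem n y hy)).1
      have hAm : AEStronglyMeasurable (fun x => dualityMap q (f x) * conj (g x / f x)) μH :=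
        (hV.aestronglyMeasurable_dualityMap hp.left_mem).mul hcφ
      have h1 := integral_fderiv_eq_zero (μ := μH) (k := fun z => ((‖1 + z‖ ^ (q - 2) : ℝ) : ℂ))
        (M := 1) (s := q - 2) (by linarith)
        (Complex.ofRealCLM.hasFDerivAt.comp (0 : ℂ) (hasFDerivAt_norm_one_add_rpow (q - 2)))
        (by fun_prop) (fun z => by
          rw [one_mul, Complex.norm_real, Real.norm_of_nonneg (by positivity)]
          refine Real.rpow_le_rpow (norm_nonneg _) ?_ (by linarith)
          simpa using norm_add_le 1 z)
        (A := fun x => dualityMap q (f x) * conj (g x / f x)) (φ := fun x => ζ * (g x / f x))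
        (H := fun x => fourier n x * y x - R n y x) hAm (hφ.const_mul ζ) hHm ?_ ?_
      · rw [← h1]
        congr 1; ext x
        simp only [ContinuousLinearMap.comp_apply, Complex.ofRealCLM_apply, FunLike.coe_smul,
          Pi.smul_apply, Complex.reCLM_apply, smul_eq_mul, Complex.ofReal_mul, Complex.ofReal_sub,
          Complex.ofReal_ofNat]
        ring
      · refine (hV.integrable_moment_shift hp hW (m := max (q - 3) 0 + 2) ?_ hy n).mono' ?_ ?_
        · rw [← max_add_add_right, ← max_add_add_right]
          refine max_le_max ?_ ?_ <;> linarith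
        · refine AEStronglyMeasurable.mul (hAm.norm.mul ?_) hHm.norm
          exact (hφ.const_mul ζ).norm.mul
            ((((hφ.const_mul ζ).norm.aemeasurable.const_add 1).pow_const _).aestronglyMeasurable)
        · refine ae_of_all _ fun x => ?_
          rw [Real.norm_of_nonneg (by positivity)]
          have h1 : ‖ζ * (g x / f x)‖ = ‖g x / f x‖ := by rw [norm_mul, hζ, one_mul]
          rw [h1, norm_mul, RCLike.norm_conj, Real.rpow_add (by positivity),
            show q - 2 - 1 = q - 3 by ring,
            show (1 + ‖g x / f x‖) ^ (2 : ℝ) = (1 + ‖g x / f x‖) ^ 2 by norm_cast]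
          calc ‖dualityMap q (f x)‖ * ‖g x / f x‖ *
                (‖g x / f x‖ * (1 + ‖g x / f x‖) ^ max (q - 3) 0) *
                ‖fourier n x * y x - R n y x‖
              = ‖dualityMap q (f x)‖ * ((1 + ‖g x / f x‖) ^ max (q - 3) 0 * ‖g x / f x‖ ^ 2) *
                ‖fourier n x * y x - R n y x‖ := by ring
            _ ≤ _ := by gcongr; linarith
      · intro r hr
        have hgood : ∀ t : ℂ, IsGood V R (fun x => dualityMap q ((f + t • g) x) *
            conj (g x / (f + t • g) x)) := fun t =>
          (hV.isGood_first_variation (hp.add_smul t) (hV.hasMoment_of_le (hp.add_smul t) hq2.le)).1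
        have hint : ∀ t : ℂ, Integrable (fun x => dualityMap q ((f + t • g) x) *
            conj (g x / (f + t • g) x) * (fourier n x * y x - R n y x)) μH := by
          intro t
          have h1 := (integrable_fourier_mul ((hgood t).integrable y hy) n).sub
            ((hgood t).integrable _ (hV.map_mem n y hy))
          refine h1.congr (ae_of_all _ fun x => ?_)
          simp only [Pi.sub_apply]; ring
        have h4 := integral_sub (hint (r * ζ)) (hint 0)
        rw [(hgood _).factor n y hy, (hgood 0).factor n y hy, sub_zero] at h4
        refine Eq.trans ?_ h4
        refine integral_congr_ae ?_
        filter_upwards [hV.ae_ne_zero f hp.left_mem hp.left_ne_zero,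
          hV.ae_ne_zero _ (hp.add_smul (r * ζ)).left_mem (hp.add_smul_ne_zero _)] with x hx hx'
        have h5 : (f + (r * ζ) • g) x = f x * (1 + r * (ζ * (g x / f x))) := by
          simp only [Pi.add_apply, Pi.smul_apply, smul_eq_mul]; field_simp
        rw [h5] at hx' ⊢
        set c := 1 + r * (ζ * (g x / f x))
        have hc : conj c ≠ 0 := (map_ne_zero _).2 (right_ne_zero_of_mul hx')
        have h6 : dualityMap q (f x * c) * conj (g x / (f x * c)) =
            dualityMap q (f x) * conj (g x / f x) * ((‖c‖ ^ (q - 2) : ℝ) : ℂ) := by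
          rw [dualityMap_mul, ← div_div, map_div₀ _ _ c]
          conv_lhs => rw [dualityMap, dualityMap]
          rw [dualityMap]
          field_simp
        rw [h6]
        simp only [add_zero, norm_one, Real.one_rpow, Complex.ofReal_one, zero_smul]
        ring
  have k1 := key 1 (by simp)
  have kI := key Complex.I (by simp)
  have hre : ∀ z : ℂ, ((z.re : ℝ) : ℂ) = (z + conj z) / 2 := Complex.re_eq_add_conj
  have hq' : (q - 2 : ℂ) ≠ 0 := by
    have : (q - 2 : ℝ) ≠ 0 := by linarith
    exact_mod_cast this
  constructor
  · refine ((k1.add hV.map_mem (kI.const_mul (-Complex.I))).const_mul (1 / (q - 2))).congr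
      (ae_of_all _ fun x => ?_)
    simp only [hre, map_mul, Complex.conj_I, one_mul]
    field_simp
    ring_nf
    simp only [Complex.I_sq]
    ring
  · refine ((k1.add hV.map_mem (kI.const_mul Complex.I)).const_mul (1 / (q - 2))).congr
      (ae_of_all _ fun x => ?_)
    simp only [hre, map_mul, Complex.conj_I, one_mul]
    field_simp
    ring_nf
    simp only [Complex.I_sq]
    ring

end IsContractiveModel

/-! ### Higher moments after a generic change of basis. -/

/-- The singularity is integrable because the plane has real dimension 2 and `σ > -2`. The bound is
uniform in the centre: the integrand is at most 1 plus a translate of one fixed integrable function.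
-/
theorem exists_forall_setIntegral_rpow_le {σ : ℝ} (hσ : -2 < σ) (hσ0 : σ ≤ 0) (N : ℝ) :
    ∃ C : ℝ, ∀ a : ℂ, IntegrableOn (fun t : ℂ => ‖a + t‖ ^ σ) (Metric.ball 0 N) ∧
      ∫ t in Metric.ball (0 : ℂ) N, ‖a + t‖ ^ σ ≤ C := by
  set h : ℂ → ℝ := (Metric.ball (0 : ℂ) 1).indicator fun t => ‖t‖ ^ σ with hh
  have hh0 : ∀ t, 0 ≤ h t := fun t => Set.indicator_nonneg (fun t _ => by positivity) t
  have hhi : Integrable h := by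
    rw [hh, integrable_indicator_iff Metric.isOpen_ball.measurableSet]
    refine integrableOn_ball_of_norm_le_rpow (C := 1) (α := -σ) (by simp) (by simp; linarith)
      (ae_of_all _ fun t => ?_) (measurable_norm.pow_const _).aestronglyMeasurable
    rw [Real.norm_of_nonneg (by positivity), one_mul, neg_neg]
  have hle : ∀ a t : ℂ, ‖a + t‖ ^ σ ≤ h (a + t) + 1 := by
    intro a t
    by_cases hat : a + t ∈ Metric.ball (0 : ℂ) 1
    · rw [hh, Set.indicator_of_mem hat]; linarith
    · rw [hh, Set.indicator_of_notMem hat, zero_add]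
      have h1 : 1 ≤ ‖a + t‖ := by simpa using hat
      exact Real.rpow_le_one_of_one_le_of_nonpos h1 hσ0
  have hconst : IntegrableOn (fun _ : ℂ => (1 : ℝ)) (Metric.ball 0 N) :=
    integrableOn_const (by exact measure_ball_lt_top.ne)
  refine ⟨(∫ t, h t) + (volume : Measure ℂ).real (Metric.ball 0 N), fun a => ?_⟩
  have hha : Integrable (fun t => h (a + t)) := hhi.comp_add_left a
  have hb : IntegrableOn (fun t => h (a + t) + 1) (Metric.ball 0 N) := hha.integrableOn.add hconst
  have hi : IntegrableOn (fun t : ℂ => ‖a + t‖ ^ σ) (Metric.ball 0 N) := by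
    refine hb.mono' ?_ (ae_of_all _ fun t => ?_)
    · exact ((measurable_norm.comp (measurable_const_add a)).pow_const _).aestronglyMeasurable
    · rw [Real.norm_of_nonneg (by positivity)]
      exact hle a t
  refine ⟨hi, (integral_mono hi hb (hle a)).trans ?_⟩
  refine (integral_add hha.integrableOn hconst).trans_le ?_
  have h1 : ∫ t in Metric.ball (0 : ℂ) N, h (a + t) ≤ ∫ t, h t :=
    (setIntegral_le_integral hha (ae_of_all _ fun t => hh0 _)).trans_eq
      (integral_add_left_eq_self h a)
  have h2 : ∫ _ in Metric.ball (0 : ℂ) N, (1 : ℝ) = (volume : Measure ℂ).real (Metric.ball 0 N) := by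
    simp
  exact add_le_add h1 h2.le

theorem ae_integrable_mul_rpow {α : Type*} [MeasurableSpace α] {μ : Measure α} [SFinite μ]
    {σ : ℝ} (hσ : -2 < σ) (hσ0 : σ ≤ 0) {w : α → ℂ} {ρ : α → ℝ}
    (hw : AEStronglyMeasurable w μ) (hρ : Integrable ρ μ) (hρ0 : ∀ x, 0 ≤ ρ x) :
    ∀ᵐ t : ℂ, Integrable (fun x => ρ x * ‖w x + t‖ ^ σ) μ := by
  have hball : ∀ N : ℕ, ∀ᵐ t : ℂ ∂(volume.restrict (Metric.ball 0 N)),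
      Integrable (fun x => ρ x * ‖w x + t‖ ^ σ) μ := by
    intro N
    obtain ⟨C, hC⟩ := exists_forall_setIntegral_rpow_le hσ hσ0 N
    have hm : AEStronglyMeasurable (fun z : α × ℂ => ρ z.1 * ‖w z.1 + z.2‖ ^ σ)
        (μ.prod (volume.restrict (Metric.ball 0 N))) := by
      refine hρ.1.comp_fst.mul ?_
      exact (((hw.comp_fst.add measurable_snd.aestronglyMeasurable).norm.aemeasurable).pow_const
        _).aestronglyMeasurable
    have hint : Integrable (fun z : α × ℂ => ρ z.1 * ‖w z.1 + z.2‖ ^ σ)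
        (μ.prod (volume.restrict (Metric.ball 0 N))) := by
      rw [integrable_prod_iff hm]
      refine ⟨ae_of_all _ fun x => (hC (w x)).1.const_mul (ρ x), ?_⟩
      refine (hρ.const_mul C).mono' hm.norm.integral_prod_right' (ae_of_all _ fun x => ?_)
      have h1 : ∀ t : ℂ, ‖ρ x * ‖w x + t‖ ^ σ‖ = ρ x * ‖w x + t‖ ^ σ := fun t =>
        Real.norm_of_nonneg (mul_nonneg (hρ0 x) (by positivity))
      simp only [h1]
      rw [integral_const_mul, Real.norm_of_nonneg
        (mul_nonneg (hρ0 x) (integral_nonneg fun _ => by positivity)), mul_comm]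
      exact mul_le_mul_of_nonneg_right (hC (w x)).2 (hρ0 x)
    exact hint.prod_left_ae
  have h2 : ∀ᵐ t : ℂ, ∀ N : ℕ, t ∈ Metric.ball (0 : ℂ) N →
      Integrable (fun x => ρ x * ‖w x + t‖ ^ σ) μ :=
    ae_all_iff.2 fun N => (ae_restrict_iff' Metric.isOpen_ball.measurableSet).1 (hball N)
  filter_upwards [h2] with t ht
  obtain ⟨N, hN⟩ := exists_nat_gt ‖t‖
  exact ht N (by simpa using hN)

namespace IsContractiveModel

variable {f g : 𝕋 → ℂ}

/-- With `F = f + t g`, one has `|F|^q |g/F|^j = |g|^q |f/g + t|^(q-j)`. Since `q - j > -2`, Fubini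
in `t` makes this integrable for almost every `t`. -/
theorem ae_hasMoment_add_smul (hV : IsContractiveModel q V R) (hp : IsPair V f g) {j : ℝ}
    (hj : q ≤ j) (hj2 : j < q + 2) : ∀ᵐ t : ℂ, HasMoment q (f + t • g) g j := by
  have hq : 0 < q := by linarith [hV.one_le]
  have hgI := (hV.memLp g hp.right_mem).integrable_norm_rpow (by simpa using hq)
    ENNReal.ofReal_ne_top
  rw [ENNReal.toReal_ofReal hq.le] at hgI
  filter_upwards [ae_integrable_mul_rpow (σ := q - j) (by linarith) (by linarith)
    (hV.aestronglyMeasurable_div hp.swap) hgI (fun x => by positivity)] with t ht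
  have hp' := hp.add_smul t
  have hFI := (hV.memLp _ hp'.left_mem).integrable_norm_rpow (by simpa using hq)
    ENNReal.ofReal_ne_top
  rw [ENNReal.toReal_ofReal hq.le] at hFI
  refine ((hFI.add ht).const_mul (2 ^ j)).mono' ?_ ?_
  · refine AEStronglyMeasurable.mul hFI.1 ?_
    exact (((hV.aestronglyMeasurable_div hp').norm.aemeasurable.const_add 1).pow_const
      _).aestronglyMeasurable
  · filter_upwards [hV.ae_ne_zero _ hp'.left_mem hp'.left_ne_zero,
      hV.ae_ne_zero _ hp.right_mem hp.swap.left_ne_zero] with x hx hgx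
    have h1 : (f + t • g) x = g x * (f x / g x + t) := by
      simp only [Pi.add_apply, Pi.smul_apply, smul_eq_mul]; field_simp
    rw [max_eq_right hj, Real.norm_of_nonneg (by positivity)]
    simp only [Pi.add_apply] at h1 hx ⊢
    set F := f x + (t • g) x
    have hF : 0 < ‖F‖ := norm_pos_iff.2 hx
    have hg0 : 0 < ‖g x‖ := norm_pos_iff.2 hgx
    have h2 : ‖g x‖ ^ q * ‖f x / g x + t‖ ^ (q - j) = ‖F‖ ^ q * ‖g x / F‖ ^ j := by
      have h3 : ‖f x / g x + t‖ = ‖F‖ / ‖g x‖ := by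
        rw [h1, norm_mul]; field_simp
      rw [h3, norm_div, Real.div_rpow hF.le hg0.le, Real.div_rpow hg0.le hF.le,
        Real.rpow_sub hF, Real.rpow_sub hg0]
      field_simp
    rw [h2, ← mul_one_add (‖F‖ ^ q), mul_left_comm]
    gcongr
    have hm : 1 + ‖g x / F‖ ≤ 2 * max 1 ‖g x / F‖ := by
      linarith [le_max_left 1 ‖g x / F‖, le_max_right 1 ‖g x / F‖]
    have hj0 : 0 ≤ j := by linarith
    calc (1 + ‖g x / F‖) ^ j ≤ (2 * max 1 ‖g x / F‖) ^ j := by gcongr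
      _ = 2 ^ j * (max 1 ‖g x / F‖) ^ j := Real.mul_rpow (by norm_num) (by positivity)
      _ ≤ 2 ^ j * (1 + ‖g x / F‖ ^ j) := by
        gcongr
        rcases max_cases 1 ‖g x / F‖ with h | h
        · rw [h.1, Real.one_rpow]
          exact le_add_of_nonneg_right (by positivity)
        · rw [h.1]
          exact le_add_of_nonneg_left zero_le_one

/-! ### Values of the quotient, and real relations between good functions. -/

theorem ae_div_ne (hV : IsContractiveModel q V R) (hp : IsPair V f g) (c : ℂ) :
    ∀ᵐ x ∂μH, g x / f x ≠ c := by
  have h := (hp.smul_sub_smul one_ne_zero c).swap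
  filter_upwards [hV.ae_ne_zero _ h.left_mem h.left_ne_zero,
    hV.ae_ne_zero f hp.left_mem hp.left_ne_zero] with x hx hfx hc
  apply hx
  simp only [Pi.sub_apply, Pi.smul_apply, smul_eq_mul, ← hc]
  field_simp
  ring

theorem ae_eval_div_ne_zero (hV : IsContractiveModel q V R) (hp : IsPair V f g)
    {Q : Polynomial ℂ} (hQ : Q ≠ 0) : ∀ᵐ x ∂μH, Q.eval (g x / f x) ≠ 0 := by
  have h : ∀ᵐ x ∂μH, ∀ c ∈ Q.roots.toFinset, g x / f x ≠ c :=
    (Finset.eventually_all _).2 fun c _ => hV.ae_div_ne hp c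
  filter_upwards [h] with x hx h0
  exact hx _ (by simpa [hQ] using h0) rfl

/-- Real linear combinations of good functions satisfying finitely many linear equations vanish. -/
theorem ae_sum_eq_zero (hV : IsContractiveModel q V R) (hp : IsPair V f g) {ι : Type*} [Fintype ι]
    {K : ι → 𝕋 → ℂ} (hK : ∀ i, IsGood V R (K i))
    (hreal : ∀ i, ∀ᵐ x ∂μH, conj (K i x * f x) = K i x * f x) {c : ι → ℝ}
    (hf : ∑ i, c i • ∫ x, K i x * f x ∂μH = 0) (hg : ∑ i, c i • ∫ x, K i x * g x ∂μH = 0) :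
    ∀ᵐ x ∂μH, ∑ i, (c i : ℂ) * K i x = 0 := by
  have hgood := IsGood.sum hV.map_mem Finset.univ (fun i _ => hK i) (fun i => (c i : ℂ))
  have hint : ∀ y ∈ V, ∫ x, (∑ i, (c i : ℂ) * K i x) * y x ∂μH = ∑ i, c i • ∫ x, K i x * y x ∂μH := by
    intro y hy
    simp_rw [Finset.sum_mul, mul_assoc]
    rw [integral_finsetSum _ fun i _ => ((hK i).integrable y hy).const_mul _]
    refine Finset.sum_congr rfl fun i _ => ?_
    rw [integral_const_mul, Complex.real_smul]
  have h0 := hgood.ae_eq_zero_of_real hV.map_mem hp ((hint f hp.left_mem).trans hf)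
    ((hint g hp.right_mem).trans hg) hp.left_mem (by
      filter_upwards [ae_all_iff.2 hreal] with x hx
      rw [Finset.sum_mul, map_sum]
      refine Finset.sum_congr rfl fun i _ => ?_
      rw [mul_assoc, map_mul, hx i, Complex.conj_ofReal])
  filter_upwards [h0, hV.ae_ne_zero f hp.left_mem hp.left_ne_zero] with x hx hfx
  exact (mul_eq_zero.1 hx).resolve_right hfx

/-- A dimension count: annihilating `f` is one real equation, as `K i * f` is real, and annihilating
`g` is two. Four unknown real coefficients therefore suffice. -/
theorem exists_real_relation (hV : IsContractiveModel q V R) (hp : IsPair V f g)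
    {K : Fin 4 → 𝕋 → ℂ} (hK : ∀ i, IsGood V R (K i))
    (hreal : ∀ i, ∀ᵐ x ∂μH, conj (K i x * f x) = K i x * f x) :
    ∃ c : Fin 4 → ℝ, (∃ i, c i ≠ 0) ∧ ∀ᵐ x ∂μH, ∑ i, (c i : ℂ) * K i x = 0 := by
  have hnl : ¬ LinearIndependent ℝ (fun i => (((∫ x, K i x * f x ∂μH).re,
      ∫ x, K i x * g x ∂μH) : ℝ × ℂ)) := fun hl => by
    have := hl.fintype_card_le_finrank
    simp at this
  obtain ⟨c, hc, hi⟩ := Fintype.not_linearIndependent_iff.1 hnl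
  refine ⟨c, hi, hV.ae_sum_eq_zero hp hK hreal ?_ ?_⟩
  · have h1 := congrArg Prod.fst hc
    simp only [Prod.fst_sum, Prod.smul_fst, Prod.fst_zero] at h1
    have h2 : ∀ i, ∫ x, K i x * f x ∂μH = (((∫ x, K i x * f x ∂μH).re : ℝ) : ℂ) := by
      intro i
      rw [eq_comm, ← Complex.conj_eq_iff_re, ← integral_conj]
      exact integral_congr_ae (hreal i)
    have h3 := congrArg (fun r : ℝ => (r : ℂ)) h1
    simp only [Complex.ofReal_sum, smul_eq_mul, Complex.ofReal_mul, Complex.ofReal_zero] at h3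
    rw [← h3]
    refine Finset.sum_congr rfl fun i _ => ?_
    rw [Complex.real_smul, ← h2 i]
  · have h1 := congrArg Prod.snd hc
    simpa only [Prod.snd_sum, Prod.smul_snd, Prod.snd_zero] using h1

/-- When `K i * g` is real as well, there are only two real equations, so three functions suffice.
-/
theorem exists_real_relation' (hV : IsContractiveModel q V R) (hp : IsPair V f g)
    {K : Fin 3 → 𝕋 → ℂ} (hK : ∀ i, IsGood V R (K i))
    (hreal : ∀ i, ∀ᵐ x ∂μH, conj (K i x * f x) = K i x * f x)
    (hreal' : ∀ i, ∀ᵐ x ∂μH, conj (K i x * g x) = K i x * g x) :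
    ∃ c : Fin 3 → ℝ, (∃ i, c i ≠ 0) ∧ ∀ᵐ x ∂μH, ∑ i, (c i : ℂ) * K i x = 0 := by
  have hnl : ¬ LinearIndependent ℝ (fun i => (((∫ x, K i x * f x ∂μH).re,
      (∫ x, K i x * g x ∂μH).re) : ℝ × ℝ)) := fun hl => by
    have := hl.fintype_card_le_finrank
    simp at this
  obtain ⟨c, hc, hi⟩ := Fintype.not_linearIndependent_iff.1 hnl
  have key : ∀ y : 𝕋 → ℂ, (∀ i, ∀ᵐ x ∂μH, conj (K i x * y x) = K i x * y x) →
      ∑ i, c i * (∫ x, K i x * y x ∂μH).re = 0 → ∑ i, c i • ∫ x, K i x * y x ∂μH = 0 := by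
    intro y hy h1
    have h2 : ∀ i, ∫ x, K i x * y x ∂μH = (((∫ x, K i x * y x ∂μH).re : ℝ) : ℂ) := by
      intro i
      rw [eq_comm, ← Complex.conj_eq_iff_re, ← integral_conj]
      exact integral_congr_ae (hy i)
    have h3 := congrArg (fun r : ℝ => (r : ℂ)) h1
    simp only [Complex.ofReal_sum, Complex.ofReal_mul, Complex.ofReal_zero] at h3
    rw [← h3]
    refine Finset.sum_congr rfl fun i _ => ?_
    rw [Complex.real_smul, ← h2 i]
  refine ⟨c, hi, hV.ae_sum_eq_zero hp hK hreal (key f hreal ?_) (key g hreal' ?_)⟩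
  · have h1 := congrArg Prod.fst hc
    simpa only [Prod.fst_sum, Prod.smul_fst, Prod.fst_zero, smul_eq_mul] using h1
  · have h1 := congrArg Prod.snd hc
    simpa only [Prod.snd_sum, Prod.smul_snd, Prod.snd_zero, smul_eq_mul] using h1

/-- The points are taken in the support of the distribution of `g/f`. A finite support would force
`g/f` to take one of its values on a set of positive measure. -/
theorem exists_injective_support (hV : IsContractiveModel q V R) (hp : IsPair V f g) (n : ℕ) :
    ∃ a : Fin n → ℂ, Function.Injective a ∧
      ∀ i, ∀ ε > 0, ∃ᵐ x ∂μH, ‖g x / f x - a i‖ < ε := by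
  have hm : AEMeasurable (fun x => g x / f x) μH := (hV.aestronglyMeasurable_div hp).aemeasurable
  set ν := (μH).map (fun x => g x / f x)
  have hinf : ν.support.Infinite := by
    intro hfin
    have h1 : ∀ᵐ x ∂μH, g x / f x ∈ ν.support := ae_of_ae_map hm Measure.support_mem_ae
    have h2 : ∀ᵐ x ∂μH, ∀ c ∈ hfin.toFinset, g x / f x ≠ c :=
      (Finset.eventually_all _).2 fun c _ => hV.ae_div_ne hp c
    obtain ⟨x, hx1, hx2⟩ := (h1.and h2).exists
    exact hx2 _ (hfin.mem_toFinset.2 hx1) rfl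
  have e := hinf.natEmbedding
  refine ⟨fun i => (e i : ℂ), fun i j hij => ?_, fun i ε hε => ?_⟩
  · exact Fin.ext (e.injective (Subtype.ext hij))
  · have h1 := (Measure.mem_support_iff_forall _).1 (e i).2 _ (Metric.ball_mem_nhds _ hε)
    replace h1 : 0 < (μH).map (fun x => g x / f x) (Metric.ball (e i : ℂ) ε) := h1
    rw [Measure.map_apply_of_aemeasurable hm Metric.isOpen_ball.measurableSet] at h1
    rw [frequently_ae_iff]
    refine ne_of_gt (h1.trans_eq ?_)
    congr 1
    ext x
    simp [dist_eq_norm]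

/-! ### Exponents below 2. -/

/-- There is no such projection for exponents below two. -/
theorem false_of_lt_two (hV : IsContractiveModel q V R) (hq2 : q < 2) (hp : IsPair V f g) :
    False := by
  have hq1 := hV.one_le
  obtain ⟨a, hainj, ha⟩ := hV.exists_injective_support hp.swap 4
  obtain ⟨δ, hδ, hsep⟩ : ∃ δ : ℝ, 0 < δ ∧ ∀ i j, i ≠ j → 4 * δ ≤ ‖a i - a j‖ := by
    have : Nonempty {z : Fin 4 × Fin 4 // z.1 ≠ z.2} := ⟨⟨(0, 1), by decide⟩⟩
    obtain ⟨⟨z, hz⟩, hmin⟩ := Finite.exists_min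
      (fun z : {z : Fin 4 × Fin 4 // z.1 ≠ z.2} => ‖a z.1.1 - a z.1.2‖)
    have hpos : 0 < ‖a z.1 - a z.2‖ := norm_pos_iff.2 (sub_ne_zero.2 (hainj.ne hz))
    refine ⟨‖a z.1 - a z.2‖ / 4, by positivity, fun i j hij => ?_⟩
    have := hmin ⟨(i, j), hij⟩
    simp only at this
    linarith
  -- The value 4 makes the singular term exceed the sum of the three others.
  obtain ⟨c₀, hc₀, hc₀1, hc₀4⟩ : ∃ c : ℝ, 0 < c ∧ c ≤ 1 ∧ c ^ (q - 2) = 4 := by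
    refine ⟨(1 / 4) ^ (1 / (2 - q)), by positivity, ?_, ?_⟩
    · refine Real.rpow_le_one (by norm_num) (by norm_num) ?_
      have : 0 < 2 - q := by linarith
      positivity
    · rw [← Real.rpow_mul (by norm_num)]
      have : 1 / (2 - q) * (q - 2) = -1 := by
        have : 2 - q ≠ 0 := by linarith
        field_simp; ring
      rw [this, Real.rpow_neg_one]; norm_num
  set η := δ * c₀ with hη
  have hη0 : 0 < η := by positivity
  have hηδ : η ≤ δ := mul_le_of_le_one_right hδ.le hc₀1
  have hdense : Dense {t : ℂ | HasMoment q (f + t • g) g 2} :=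
    Measure.dense_of_ae (hV.ae_hasMoment_add_smul hp hq2.le (by linarith))
  have ht : ∀ i, ∃ t : ℂ, HasMoment q (f + t • g) g 2 ∧ ‖a i + t‖ < η := by
    intro i
    obtain ⟨t, ht, htd⟩ := hdense.exists_dist_lt (-a i) hη0
    refine ⟨t, ht, ?_⟩
    rw [dist_eq_norm] at htd
    rwa [← norm_neg, neg_add]
  choose t htm hta using ht
  have hgood : ∀ i, IsGood V R (fun x => dualityMap q ((f + t i • g) x) *
      conj (g x / (f + t i • g) x)) := fun i =>
    (hV.isGood_first_variation (hp.add_smul (t i)) (htm i)).1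
  -- Writing `f + t g = g w` with `w = f/g + t`, the first variation `J(g w)` times the conjugate of
  -- `1/w` collapses to `J(g) |w|^(q-2)`.
  have hgood' : ∀ i, IsGood V R (fun x => dualityMap q (g x) *
      ((‖f x / g x + t i‖ ^ (q - 2) : ℝ) : ℂ)) := by
    intro i
    refine (hgood i).congr ?_
    filter_upwards [hV.ae_ne_zero _ (hp.add_smul (t i)).left_mem (hp.add_smul_ne_zero _),
      hV.ae_ne_zero _ hp.right_mem hp.swap.left_ne_zero] with x hx hgx
    have h5 : (f + t i • g) x = g x * (f x / g x + t i) := by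
      simp only [Pi.add_apply, Pi.smul_apply, smul_eq_mul]; field_simp
    rw [h5] at hx ⊢
    have hc : conj (f x / g x + t i) ≠ 0 := (map_ne_zero _).2 (right_ne_zero_of_mul hx)
    set w := f x / g x + t i
    have h6 : g x / (g x * w) = w⁻¹ := by field_simp
    rw [dualityMap_mul, h6, map_inv₀, dualityMap.eq_1 q w]
    field_simp
  obtain ⟨c, ⟨i₁, hi₁⟩, hrel⟩ := hV.exists_real_relation hp.swap hgood' (fun i => by
    refine ae_of_all _ fun x => ?_
    have h1 : dualityMap q (g x) * ((‖f x / g x + t i‖ ^ (q - 2) : ℝ) : ℂ) * g x =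
        ((‖g x‖ ^ q * ‖f x / g x + t i‖ ^ (q - 2) : ℝ) : ℂ) := by
      rw [mul_right_comm, dualityMap_mul_self (by linarith), Complex.ofReal_mul]
    rw [h1, Complex.conj_ofReal])
  -- The relation is evaluated at a point where `f/g` is close to `a i₀`, hence to `-t i₀`, for a
  -- coefficient of largest modulus. There term `i₀` is at least `4 (2δ)^(q-2)`, and each other term
  -- is at most `(2δ)^(q-2)`.
  obtain ⟨i₀, hmax⟩ := Finite.exists_max (fun i => |c i|)
  have hci : 0 < |c i₀| := (abs_pos.2 hi₁).trans_le (hmax i₁)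
  obtain ⟨x, hxa, hrelx, hgx, hne⟩ := ((ha i₀ η hη0).and_eventually (hrel.and
    ((hV.ae_ne_zero _ hp.right_mem hp.swap.left_ne_zero).and
      (hV.ae_div_ne hp.swap (-t i₀))))).exists
  have hgx' := dualityMap_ne_zero (q := q) hgx
  set A : Fin 4 → ℝ := fun i => ‖f x / g x + t i‖ ^ (q - 2) with hA
  have hsum : ∑ i, c i * A i = 0 := by
    have h1 : dualityMap q (g x) * ((∑ i, c i * A i : ℝ) : ℂ) = 0 := by
      rw [← hrelx, Complex.ofReal_sum, Finset.mul_sum]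
      refine Finset.sum_congr rfl fun i _ => ?_
      push_cast; ring
    exact_mod_cast (mul_eq_zero.1 h1).resolve_left hgx'
  have hfar : ∀ j, j ≠ i₀ → A j ≤ (2 * δ) ^ (q - 2) := by
    intro j hj
    refine Real.rpow_le_rpow_of_nonpos (by positivity) ?_ (by linarith)
    have h1 := hsep i₀ j hj.symm
    have h2 : a i₀ - a j = (f x / g x + t j) - (f x / g x - a i₀) - (a j + t j) := by ring
    have h3 : ‖a i₀ - a j‖ ≤ ‖f x / g x + t j‖ + ‖f x / g x - a i₀‖ + ‖a j + t j‖ := by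
      rw [h2]
      exact (norm_sub_le _ _).trans (add_le_add_left (norm_sub_le _ _) _)
    linarith [hta j]
  have hpos : 0 < (2 * δ) ^ (q - 2) := by positivity
  have hnear : 4 * (2 * δ) ^ (q - 2) ≤ A i₀ := by
    replace hne : f x / g x + t i₀ ≠ 0 := fun h => hne (eq_neg_of_add_eq_zero_left h)
    have h1 : ‖f x / g x + t i₀‖ ≤ 2 * η := by
      have h2 : f x / g x + t i₀ = (f x / g x - a i₀) + (a i₀ + t i₀) := by ring
      rw [h2]
      refine (norm_add_le _ _).trans ?_
      linarith [hta i₀]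
    calc 4 * (2 * δ) ^ (q - 2) = (2 * η) ^ (q - 2) := by
          rw [hη, ← mul_assoc, Real.mul_rpow (by positivity) hc₀.le, hc₀4, mul_comm]
      _ ≤ A i₀ := Real.rpow_le_rpow_of_nonpos (norm_pos_iff.2 hne) h1 (by linarith)
  have hA0 : ∀ i, 0 ≤ A i := fun i => by positivity
  have h1 : |c i₀| * A i₀ ≤ |c i₀| * (3 * (2 * δ) ^ (q - 2)) := by
    rw [← Finset.add_sum_erase _ _ (Finset.mem_univ i₀), add_eq_zero_iff_eq_neg] at hsum
    calc |c i₀| * A i₀ = |∑ i ∈ Finset.univ.erase i₀, c i * A i| := by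
          rw [← abs_neg (∑ i ∈ _, _), ← hsum, abs_mul, abs_of_nonneg (hA0 i₀)]
      _ ≤ ∑ i ∈ Finset.univ.erase i₀, |c i₀| * (2 * δ) ^ (q - 2) := by
          refine (Finset.abs_sum_le_sum_abs _ _).trans (Finset.sum_le_sum fun j hj => ?_)
          rw [abs_mul, abs_of_nonneg (hA0 j)]
          exact mul_le_mul (hmax j) (hfar j (Finset.ne_of_mem_erase hj)) (hA0 j) (abs_nonneg _)
      _ = |c i₀| * (3 * (2 * δ) ^ (q - 2)) := by
          rw [Finset.sum_const, Finset.card_erase_of_mem (Finset.mem_univ _)]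
          simp
          ring
  have h2 := le_of_mul_le_mul_left h1 hci
  linarith

/-! ### Exponents above 2. -/

theorem hasMoment_smul_sub_smul (hV : IsContractiveModel q V R) (hp : IsPair V f g) {j : ℝ}
    (hW : HasMoment q f g j) {a : ℂ} (ha : a ≠ 0) (b : ℂ) :
    HasMoment q f (a • g - b • f) j := by
  have hq : 0 < q := by linarith [hV.one_le]
  have hp' := hp.smul_sub_smul ha b
  have hm : 0 ≤ max q j := hq.le.trans (le_max_left _ _)
  refine (hW.const_mul ((1 + ‖a‖ + ‖b‖) ^ (max q j))).mono' ?_ ?_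
  · refine AEStronglyMeasurable.mul
      ((hV.memLp f hp.left_mem).1.norm.aemeasurable.pow_const _).aestronglyMeasurable ?_
    exact (((hV.aestronglyMeasurable_div hp').norm.aemeasurable.const_add 1).pow_const
      _).aestronglyMeasurable
  · filter_upwards [hV.ae_ne_zero f hp.left_mem hp.left_ne_zero] with x hx
    rw [Real.norm_of_nonneg (by positivity), mul_left_comm,
      ← Real.mul_rpow (by positivity) (by positivity)]
    gcongr
    have h1 : (a • g - b • f) x / f x = a * (g x / f x) - b := by
      simp only [Pi.sub_apply, Pi.smul_apply, smul_eq_mul]; field_simp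
    rw [h1]
    have h2 := norm_sub_le (a * (g x / f x)) b
    rw [norm_mul] at h2
    nlinarith [norm_nonneg a, norm_nonneg b, norm_nonneg (g x / f x),
      mul_nonneg (norm_nonneg b) (norm_nonneg (g x / f x))]

/-- The quotient of the basis functions cannot be real valued. -/
theorem false_of_real (hV : IsContractiveModel q V R) (hq2 : 2 < q) (hp : IsPair V f g)
    (hW : HasMoment q f g 3) (hreal : ∀ᵐ x ∂μH, conj (g x / f x) = g x / f x) : False := by
  have hq : 0 < q := by linarith
  have h0 := hV.isGood_dualityMap hp
  have h1 := (hV.isGood_first_variation hp (hV.hasMoment_of_le hp hq2.le)).1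
  have h2 := (hV.isGood_second_variation hq2 hp hW).1
  have hf := hV.ae_ne_zero f hp.left_mem hp.left_ne_zero
  -- For real `φ` the variations are `J(f)`, `J(f) φ`, `J(f) φ²`, real against both `f` and `g`. A
  -- relation among them is a polynomial equation for `φ`.
  have hK : ∀ i : Fin 3, IsGood V R (fun x => dualityMap q (f x) * (g x / f x) ^ (i : ℕ)) := by
    intro i
    fin_cases i
    · simpa using h0
    · refine h1.congr ?_
      filter_upwards [hreal] with x hx
      simp [hx]
    · refine h2.congr ?_
      filter_upwards [hreal] with x hx
      simp [hx, sq]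
  have hr : ∀ i : Fin 3, ∀ᵐ x ∂μH, conj (dualityMap q (f x) * (g x / f x) ^ (i : ℕ) * f x) =
      dualityMap q (f x) * (g x / f x) ^ (i : ℕ) * f x := by
    intro i
    filter_upwards [hreal] with x hx
    rw [mul_right_comm, dualityMap_mul_self hq, map_mul, map_pow, hx, Complex.conj_ofReal]
  obtain ⟨c, ⟨i, hi⟩, hc⟩ := hV.exists_real_relation' hp hK hr (fun i => by
    filter_upwards [hreal, hr i, hf] with x hx hx' hfx
    have h3 : g x = f x * (g x / f x) := by field_simp
    have h4 : dualityMap q (f x) * (g x / f x) ^ (i : ℕ) * g x =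
        dualityMap q (f x) * (g x / f x) ^ (i : ℕ) * f x * (g x / f x) := by
      rw [mul_assoc _ (f x), ← h3]
    rw [h4, map_mul, hx', hx])
  set Q : Polynomial ℂ := ∑ i : Fin 3, Polynomial.monomial (i : ℕ) (c i : ℂ) with hQ
  have hQ0 : Q ≠ 0 := by
    intro h
    have h3 := congrArg (fun Q => Polynomial.coeff Q (i : ℕ)) h
    simp only [hQ, Polynomial.finsetSum_coeff, Polynomial.coeff_monomial, Fin.val_inj,
      Finset.sum_ite_eq', Finset.mem_univ, if_true, Polynomial.coeff_zero] at h3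
    exact hi (by exact_mod_cast h3)
  obtain ⟨x, hx1, hx2, hfx⟩ := (hc.and ((hV.ae_eval_div_ne_zero hp hQ0).and hf)).exists
  apply hx2
  have h3 : dualityMap q (f x) * Q.eval (g x / f x) = 0 := by
    rw [← hx1, hQ, Polynomial.eval_finsetSum, Finset.mul_sum]
    refine Finset.sum_congr rfl fun i _ => ?_
    rw [Polynomial.eval_monomial]; ring
  exact (mul_eq_zero.1 h3).resolve_left (dualityMap_ne_zero hfx)

/-- The quotient of the basis functions cannot be unimodular. -/
theorem false_of_unimodular (hV : IsContractiveModel q V R) (hq2 : 2 < q) (hp : IsPair V f g)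
    (hW : HasMoment q f g 3) (hnorm : ∀ᵐ x ∂μH, ‖g x / f x‖ = 1) : False := by
  have hq : 0 < q := by linarith
  have hq2' : (q - 2 : ℂ) ≠ 0 := by
    have : (q - 2 : ℝ) ≠ 0 := by linarith
    exact_mod_cast this
  have hf := hV.ae_ne_zero f hp.left_mem hp.left_ne_zero
  have hconj : ∀ᵐ x ∂μH, conj (g x / f x) * (g x / f x) = 1 := by
    filter_upwards [hnorm] with x hx
    rw [Complex.conj_mul', hx]; simp
  have g0 := hV.isGood_dualityMap hp
  obtain ⟨gc, gφ'⟩ := hV.isGood_first_variation hp (hV.hasMoment_of_le hp hq2.le)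
  have gφ : IsGood V R (fun x => dualityMap q (f x) * (g x / f x)) := by
    refine (gφ'.const_mul (1 / (q - 2))).congr (ae_of_all _ fun x => ?_)
    field_simp
  have gcc := (hV.isGood_second_variation hq2 hp hW).2
  obtain ⟨φ, hφ⟩ : ∃ φ : 𝕋 → ℂ, ∀ x, g x / f x = φ x := ⟨_, fun _ => rfl⟩
  obtain ⟨J, hJ⟩ : ∃ J : 𝕋 → ℂ, ∀ x, dualityMap q (f x) = J x := ⟨_, fun _ => rfl⟩
  have hJf : ∀ x, J x * f x = ((‖f x‖ ^ q : ℝ) : ℂ) := fun x => by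
    rw [← hJ, dualityMap_mul_self hq]
  have hJ0 : ∀ x, f x ≠ 0 → J x ≠ 0 := fun x hx => by rw [← hJ]; exact dualityMap_ne_zero hx
  have hroot := fun (Q : Polynomial ℂ) (hQ : Q ≠ 0) => hV.ae_eval_div_ne_zero hp hQ
  have hne := hV.ae_div_ne hp
  have hg : ∀ᵐ x ∂μH, g x = φ x * f x := by
    filter_upwards [hf] with x hx
    rw [← hφ]; field_simp
  simp only [hφ, hJ] at g0 gc gφ gcc hconj hroot hne
  have hcJ : ∀ x, conj (J x * f x) = J x * f x := fun x => by rw [hJf, Complex.conj_ofReal]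
  set M := ∫ x, J x * f x ∂μH with hM
  set m := ∫ x, J x * φ x * f x ∂μH with hm
  set s := ∫ x, J x * φ x * g x ∂μH with hs
  have i1 : ∫ x, J x * g x ∂μH = m := integral_congr_ae (by
    filter_upwards [hg] with x hx; rw [hx]; ring)
  have i2 : ∫ x, J x * conj (φ x) * f x ∂μH = conj m := by
    rw [hm, ← integral_conj]
    congr 1; ext x
    rw [mul_right_comm, mul_right_comm (J x) (φ x), map_mul, hcJ]
  have i3 : ∫ x, J x * conj (φ x) * g x ∂μH = M := integral_congr_ae (by
    filter_upwards [hg, hconj] with x hx hx'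
    rw [hx]
    linear_combination (J x * f x) * hx')
  have i4 : ∫ x, J x * (conj (φ x) * conj (φ x)) * f x ∂μH = conj s := by
    rw [hs, ← integral_conj]
    refine integral_congr_ae ?_
    filter_upwards [hg] with x hx
    rw [hx, show J x * φ x * (φ x * f x) = (J x * f x) * (φ x * φ x) by ring, map_mul, hcJ,
      map_mul]
    ring
  have i5 : ∫ x, J x * (conj (φ x) * conj (φ x)) * g x ∂μH = conj m := by
    rw [← i2]
    refine integral_congr_ae ?_
    filter_upwards [hg, hconj] with x hx hx'
    rw [hx]
    linear_combination (J x * f x * conj (φ x)) * hx'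
  have hMc : conj M = M := by
    rw [hM, ← integral_conj]
    congr 1; ext x
    rw [hcJ]
  have lin3 : ∀ {K₁ K₂ K₃ : 𝕋 → ℂ} (c₂ c₃ : ℂ), IsGood V R (fun x => J x * K₁ x) →
      IsGood V R (fun x => J x * K₂ x) → IsGood V R (fun x => J x * K₃ x) →
      IsGood V R (fun x => J x * (K₁ x + c₂ * K₂ x + c₃ * K₃ x)) ∧
      ∀ y ∈ V, ∫ x, J x * (K₁ x + c₂ * K₂ x + c₃ * K₃ x) * y x ∂μH =
        ∫ x, J x * K₁ x * y x ∂μH + c₂ * ∫ x, J x * K₂ x * y x ∂μH +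
        c₃ * ∫ x, J x * K₃ x * y x ∂μH := by
    intro K₁ K₂ K₃ c₂ c₃ h₁ h₂ h₃
    refine ⟨((h₁.add hV.map_mem (h₂.const_mul c₂)).add hV.map_mem (h₃.const_mul c₃)).congr
      (ae_of_all _ fun x => by ring), fun y hy => ?_⟩
    rw [← integral_const_mul, ← integral_const_mul,
      ← integral_add (h₁.integrable y hy) ((h₂.integrable y hy).const_mul c₂)]
    refine Eq.trans ?_ (integral_add ((h₁.integrable y hy).add ((h₂.integrable y hy).const_mul c₂))
        ((h₃.integrable y hy).const_mul c₃))
    congr 1; ext x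
    ring
  have g0' : IsGood V R (fun x => J x * 1) := by simpa using g0
  have hMne : M ≠ 0 := by
    intro h0
    simp_rw [hM, hJf] at h0
    rw [integral_complex_ofReal, Complex.ofReal_eq_zero, integral_eq_zero_iff_of_nonneg
      (fun x => by positivity)] at h0
    · obtain ⟨x, hx, hx'⟩ := (h0.and hf).exists
      exact (Real.rpow_pos_of_pos (norm_pos_iff.2 hx') q).ne' hx
    · refine (g0.integrable f hp.left_mem).norm.congr (ae_of_all _ fun x => ?_)
      simp only [hJf]
      rw [Complex.norm_real, Real.norm_of_nonneg (by positivity)]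
  -- Strict Cauchy–Schwarz: the integral of `|f|^q |M φ - m|²` equals `M (M² - |m|²)`, so a zero
  -- determinant would make `φ` constant.
  have hΔ : M * M - m * conj m ≠ 0 := by
    intro hΔ
    have gk : IsGood V R (fun x => J x * (fun _ => M * M + m * conj m) x) :=
      (g0.const_mul (M * M + m * conj m)).congr (ae_of_all _ fun x => by ring)
    obtain ⟨hgood, hint⟩ := lin3 (-(M * conj m)) (-(M * m)) gk gφ gc
    have hN : ∀ᵐ x ∂μH, J x * (M * M + m * conj m + -(M * conj m) * φ x +
        -(M * m) * conj (φ x)) * f x = ((‖M * φ x - m‖ ^ 2 * ‖f x‖ ^ q : ℝ) : ℂ) := by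
      filter_upwards [hconj] with x hx
      rw [Complex.ofReal_mul, ← hJf, Complex.ofReal_pow, ← Complex.mul_conj', map_sub, map_mul, hMc]
      linear_combination (-(J x * f x * M * M)) * hx
    have h1 := hint f hp.left_mem
    have h2 : ∫ x, J x * (fun _ => M * M + m * conj m) x * f x ∂μH = (M * M + m * conj m) * M := by
      refine Eq.trans ?_ (integral_const_mul (M * M + m * conj m) fun x => J x * f x)
      congr 1; ext x; ring
    rw [h2, ← hm, i2] at h1
    replace h1 := h1.trans (by linear_combination M * hΔ : _ = (0 : ℂ))
    rw [integral_congr_ae hN, integral_complex_ofReal, Complex.ofReal_eq_zero,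
      integral_eq_zero_iff_of_nonneg (fun x => by positivity)] at h1
    · obtain ⟨x, hx, hx', hx''⟩ := (h1.and (hf.and (hne (m / M)))).exists
      have h3 : 0 < ‖f x‖ ^ q := Real.rpow_pos_of_pos (norm_pos_iff.2 hx') q
      have h4 : ‖M * φ x - m‖ ^ 2 = 0 := (mul_eq_zero.1 hx).resolve_right h3.ne'
      have h5 : M * φ x = m := sub_eq_zero.1 (norm_eq_zero.1 (pow_eq_zero_iff two_ne_zero |>.1 h4))
      exact hx'' (by rw [← h5]; field_simp)
    · refine (hgood.integrable f hp.left_mem).norm.congr ?_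
      filter_upwards [hN] with x hx
      rw [hx, Complex.norm_real, Real.norm_of_nonneg (by positivity)]
  -- Cramer's rule. The equations say that `K = J (φ - x₀ - y₀ φ̄)` annihilates `f` and `g`; their
  -- conjugates say the same of `K' = J (φ̄² - ȳ₀ - x̄₀ φ̄)`.
  obtain ⟨x₀, y₀, e1, e2⟩ : ∃ x₀ y₀ : ℂ, m = x₀ * M + y₀ * conj m ∧ s = x₀ * m + y₀ * M := by
    refine ⟨(m * M - s * conj m) / (M * M - m * conj m), (s * M - m * m) / (M * M - m * conj m),
      ?_, ?_⟩ <;>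
    · rw [div_mul_eq_mul_div, div_mul_eq_mul_div, ← add_div, eq_div_iff hΔ]
      ring
  have e1' := congrArg conj e1
  have e2' := congrArg conj e2
  simp only [map_add, map_mul, hMc, Complex.conj_conj] at e1' e2'
  obtain ⟨k1, k1i⟩ := lin3 (-x₀) (-y₀) gφ g0' gc
  obtain ⟨k2, k2i⟩ := lin3 (-conj y₀) (-conj x₀) gcc g0' gc
  simp only [mul_one] at k1 k2
  have z1f := k1i f hp.left_mem
  have z1g := k1i g hp.right_mem
  have z2f := k2i f hp.left_mem
  have z2g := k2i g hp.right_mem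
  simp only [mul_one] at z1f z1g z2f z2g
  rw [← hM, ← hm, i2] at z1f
  rw [← hs, i1, i3] at z1g
  rw [i4, ← hM, i2] at z2f
  rw [i5, i1, i3] at z2g
  replace z1f := z1f.trans (by linear_combination e1 : _ = (0 : ℂ))
  replace z1g := z1g.trans (by linear_combination e2 : _ = (0 : ℂ))
  replace z2f := z2f.trans (by linear_combination e2' : _ = (0 : ℂ))
  replace z2g := z2g.trans (by linear_combination e1' : _ = (0 : ℂ))
  -- As `φ φ̄ = 1`, `K g = |f|^q (φ² - x₀ φ - y₀)` is the conjugate of `K' f`. It is thus both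
  -- analytic of mean zero and antianalytic, so it vanishes, which is a quadratic equation for `φ`.
  have hzero := ae_eq_zero_of_analytic_of_conj (k1.integrable g hp.right_mem)
    (k1.integral_fourier_mul hV.map_mem hp z1f z1g hp.right_mem) (fun n => by
      rw [← k2.integral_fourier_mul hV.map_mem hp z2f z2g hp.left_mem n]
      refine integral_congr_ae ?_
      filter_upwards [hg, hconj] with x hx hx'
      rw [hx, show J x * (φ x + -x₀ + -y₀ * conj (φ x)) * (φ x * f x) =
        (J x * f x) * (φ x * φ x + -x₀ * φ x + -y₀ * (conj (φ x) * φ x)) by ring, hx', map_mul, hcJ]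
      simp only [map_add, map_mul, map_neg, map_one]
      ring)
  set Q : Polynomial ℂ := Polynomial.X ^ 2 - Polynomial.C x₀ * Polynomial.X - Polynomial.C y₀ with hQ
  have hQ0 : Q ≠ 0 := by
    intro h
    have h3 := congrArg (fun Q => Polynomial.coeff Q 2) h
    simp [hQ] at h3
  obtain ⟨x, hx1, hx2, hx3, hx4, hx5⟩ := (hzero.and ((hroot Q hQ0).and
    (hconj.and (hg.and hf)))).exists
  apply hx2
  have h3 : (J x * f x) * Q.eval (φ x) = 0 := by
    simp only [Pi.zero_apply] at hx1
    rw [hx4] at hx1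
    simp only [hQ, Polynomial.eval_sub, Polynomial.eval_pow, Polynomial.eval_X, Polynomial.eval_mul,
      Polynomial.eval_C]
    linear_combination hx1 + J x * f x * y₀ * hx3
  exact (mul_eq_zero.1 h3).resolve_left (mul_ne_zero (hJ0 x hx5) hx5)

/-- There is no such projection for exponents above two. -/
theorem false_of_two_lt (hV : IsContractiveModel q V R) (hq2 : 2 < q) (hp : IsPair V f g) :
    False := by
  -- The third moment is automatic for `q ≥ 3`; otherwise `f` is replaced by a generic `f + t g`,
  -- which is possible since `3 < q + 2`.
  wlog hW : HasMoment q f g 3 generalizing f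
  · rcases le_total 3 q with h3 | h3
    · exact this hp (hV.hasMoment_of_le hp h3)
    · obtain ⟨t, ht⟩ := (hV.ae_hasMoment_add_smul hp h3 (by linarith)).exists
      exact this (hp.add_smul t) ht
  have hq : 0 < q := by linarith
  have hq2' : (q - 2 : ℂ) ≠ 0 := by
    have : (q - 2 : ℝ) ≠ 0 := by linarith
    exact_mod_cast this
  have hf := hV.ae_ne_zero f hp.left_mem hp.left_ne_zero
  have g0 := hV.isGood_dualityMap hp
  obtain ⟨gc, gφ'⟩ := hV.isGood_first_variation hp (hV.hasMoment_of_le hp hq2.le)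
  have gφ : IsGood V R (fun x => dualityMap q (f x) * (g x / f x)) := by
    refine (gφ'.const_mul (1 / (q - 2))).congr (ae_of_all _ fun x => ?_)
    field_simp
  have gn := (hV.isGood_second_variation hq2 hp hW).1
  set u : Fin 4 → ℂ → ℝ := ![fun _ => 1, Complex.re, Complex.im, Complex.normSq] with hu
  have hK : ∀ i, IsGood V R (fun x => dualityMap q (f x) * (u i (g x / f x) : ℂ)) := by
    intro i
    fin_cases i
    · simpa [hu] using g0
    · refine ((gφ.add hV.map_mem gc).const_mul (1 / 2)).congr (ae_of_all _ fun x => ?_)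
      simp only [hu, Fin.mk_one, Matrix.cons_val_one, Matrix.cons_val_zero]
      rw [Complex.re_eq_add_conj]
      ring
    · refine ((gφ.add hV.map_mem (gc.const_mul (-1))).const_mul (1 / (2 * Complex.I))).congr
        (ae_of_all _ fun x => ?_)
      simp only [hu, Fin.reduceFinMk, Matrix.cons_val]
      rw [Complex.im_eq_sub_conj]
      ring
    · refine gn.congr (ae_of_all _ fun x => ?_)
      simp only [hu, Fin.reduceFinMk, Matrix.cons_val]
      rw [mul_comm (conj _), Complex.mul_conj]
  obtain ⟨c, ⟨i, hi⟩, hc⟩ := hV.exists_real_relation hp hK (fun i => ae_of_all _ fun x => by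
    rw [mul_right_comm, dualityMap_mul_self hq, ← Complex.ofReal_mul, Complex.conj_ofReal])
  have hrel : ∀ᵐ x ∂μH, c 0 + c 1 * (g x / f x).re + c 2 * (g x / f x).im +
      c 3 * Complex.normSq (g x / f x) = 0 := by
    filter_upwards [hc, hf] with x hx hfx
    have h1 : dualityMap q (f x) * ((c 0 + c 1 * (g x / f x).re + c 2 * (g x / f x).im +
      c 3 * Complex.normSq (g x / f x) : ℝ) : ℂ) = 0 := by
      rw [← hx, Fin.sum_univ_four]
      simp only [hu, Matrix.cons_val]
      push_cast
      ring
    exact_mod_cast (mul_eq_zero.1 h1).resolve_left (dualityMap_ne_zero hfx)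
  have hdiv : ∀ a b : ℂ, ∀ᵐ x ∂μH, (a • g - b • f) x / f x = a * (g x / f x) - b := fun a b => by
    filter_upwards [hf] with x hx
    simp only [Pi.sub_apply, Pi.smul_apply, smul_eq_mul]
    field_simp
  rcases eq_or_ne (c 3) 0 with h3 | h3
  -- The relation reads `c 0 + Re (β φ) = 0`, so `i β φ + i c 0` is real.
  · set β : ℂ := ⟨c 1, -c 2⟩ with hβ
    have hβ0 : β ≠ 0 := by
      intro h0
      have h1 : c 1 = 0 := congrArg Complex.re h0
      have h2 : c 2 = 0 := neg_eq_zero.1 (congrArg Complex.im h0)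
      obtain ⟨x, hx⟩ := hrel.exists
      rw [h1, h2, h3] at hx
      have h0 : c 0 = 0 := by simpa using hx
      fin_cases i <;> simp_all
    have ha : Complex.I * β ≠ 0 := mul_ne_zero Complex.I_ne_zero hβ0
    refine hV.false_of_real hq2 (hp.smul_sub_smul ha (-(Complex.I * c 0)))
      (hV.hasMoment_smul_sub_smul hp hW ha _) ?_
    filter_upwards [hrel, hdiv (Complex.I * β) (-(Complex.I * c 0))] with x hx hx'
    rw [hx', Complex.conj_eq_iff_im]
    simp only [h3, hβ] at hx ⊢
    simp
    linarith
  -- Completing the square gives the centre `d` and the squared radius `ρ`.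
  · set d : ℂ := ⟨-(c 1 / (2 * c 3)), -(c 2 / (2 * c 3))⟩ with hd
    set ρ : ℝ := Complex.normSq d - c 0 / c 3 with hρ
    have hcirc : ∀ᵐ x ∂μH, Complex.normSq (g x / f x - d) = ρ := by
      filter_upwards [hrel] with x hx
      rw [hρ, hd]
      simp only [Complex.normSq_apply, Complex.sub_re, Complex.sub_im] at hx ⊢
      field_simp
      linear_combination 4 * c 3 * hx
    have hρ0 : 0 < ρ := by
      obtain ⟨x, hx, hx'⟩ := (hcirc.and (hV.ae_div_ne hp d)).exists
      rw [← hx]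
      exact Complex.normSq_pos.2 (sub_ne_zero.2 hx')
    have ha : (((√ρ)⁻¹ : ℝ) : ℂ) ≠ 0 := Complex.ofReal_ne_zero.2 (by positivity)
    refine hV.false_of_unimodular hq2 (hp.smul_sub_smul ha ((((√ρ)⁻¹ : ℝ) : ℂ) * d))
      (hV.hasMoment_smul_sub_smul hp hW ha _) ?_
    filter_upwards [hcirc, hdiv _ ((((√ρ)⁻¹ : ℝ) : ℂ) * d)] with x hx hx'
    rw [hx', ← mul_sub, norm_mul, Complex.norm_real, Real.norm_of_nonneg (by positivity),
      Complex.norm_def, hx]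
    exact inv_mul_cancel₀ (by positivity)

end IsContractiveModel

/-! ### From contractive projections on the Hardy space to models. -/

namespace hardySpace

variable {p : ℝ≥0∞} [Fact (1 ≤ p)]

/-- The function underlying an element of the Hardy space. -/
noncomputable def toFun (u : hardySpace p) : 𝕋 → ℂ := ((u : Lp ℂ p μH) : 𝕋 → ℂ)

theorem memLp_toFun (u : hardySpace p) : MemLp (toFun u) p μH := Lp.memLp _

theorem integrable_toFun (u : hardySpace p) : Integrable (toFun u) μH :=
  (memLp_toFun u).integrable Fact.out

theorem integral_fourier_mul_toFun (u : hardySpace p) (n : ℕ) (hn : 1 ≤ n) :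
    ∫ x, fourier n x * toFun u x ∂μH = 0 := by
  have := u.2 n hn
  rw [fourierCoeff] at this
  simp only [neg_neg, smul_eq_mul] at this
  exact this

theorem toFun_add (u v : hardySpace p) : toFun (u + v) =ᵐ[μH] toFun u + toFun v := Lp.coeFn_add _ _

theorem toFun_sub (u v : hardySpace p) : toFun (u - v) =ᵐ[μH] toFun u - toFun v := Lp.coeFn_sub _ _

theorem toFun_smul (c : ℂ) (u : hardySpace p) : toFun (c • u) =ᵐ[μH] c • toFun u :=
  Lp.coeFn_smul _ _

theorem toFun_smul_add_smul (a b : ℂ) (u v : hardySpace p) :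
    toFun (a • u + b • v) =ᵐ[μH] a • toFun u + b • toFun v := by
  filter_upwards [toFun_add (a • u) (b • v), toFun_smul a u, toFun_smul b v] with x h1 h2 h3
  rw [h1, Pi.add_apply, h2, h3, Pi.add_apply]

theorem eq_zero_of_toFun {u : hardySpace p} (h : toFun u =ᵐ[μH] 0) : u = 0 :=
  Subtype.ext (Lp.ext (h.trans (Lp.coeFn_zero _ _ _).symm))

theorem ae_ne_zero {u : hardySpace p} (hu : u ≠ 0) : ∀ᵐ x ∂μH, toFun u x ≠ 0 :=
  ae_ne_zero_of_analytic (integrable_toFun u) (integral_fourier_mul_toFun u)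
    fun h => hu (eq_zero_of_toFun h)

/-- Invariance under multiplication by `e^{inθ}`, `n ≥ 0`, is what allows the projection to be
applied to shifts of its range. -/
theorem exists_shift (u : hardySpace p) (n : ℕ) :
    ∃ v : hardySpace p, toFun v =ᵐ[μH] fun x => fourier n x * toFun u x := by
  have hm : MemLp (fun x => fourier n x * toFun u x) p μH := by
    refine (memLp_toFun u).of_le
      ((fourier n).continuous.aestronglyMeasurable.mul (memLp_toFun u).1) (ae_of_all _ fun x => ?_)
    rw [norm_mul, norm_fourier_apply, one_mul]
  refine ⟨⟨hm.toLp _, fun k hk => ?_⟩, hm.coeFn_toLp⟩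
  rw [fourierCoeff_congr_ae hm.coeFn_toLp, fourierCoeff]
  have := integral_fourier_mul_toFun u (k + n) (by omega)
  rw [← this]
  congr 1; ext x
  rw [neg_neg, smul_eq_mul, ← mul_assoc, ← fourier_add]
  push_cast; rfl

theorem norm_rpow_eq_integral (hp : p ≠ ∞) (u : hardySpace p) :
    ‖u‖ ^ p.toReal = ∫ x, ‖toFun u x‖ ^ p.toReal ∂μH := by
  have hp1 : 1 ≤ p := Fact.out
  have hp0 : p ≠ 0 := (zero_lt_one.trans_le hp1).ne'
  have h1 : ‖u‖ = (eLpNorm (toFun u) p μH).toReal := Lp.norm_def _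
  have hq : 0 < p.toReal := ENNReal.toReal_pos hp0 hp
  have hI : 0 ≤ ∫ x, ‖toFun u x‖ ^ p.toReal ∂μH := integral_nonneg fun x => by positivity
  rw [h1, (memLp_toFun u).eLpNorm_eq_integral_rpow_norm hp0 hp,
    ENNReal.toReal_ofReal (by positivity), ← Real.rpow_mul hI, inv_mul_cancel₀ hq.ne',
    Real.rpow_one]

/-- Contractive projections and the duality map. -/
theorem integral_dualityMap_eq_zero (hp : p ≠ ∞) {P : hardySpace p →L[ℂ] hardySpace p}
    (hP : ‖P‖ ≤ 1) {U h : hardySpace p} (hU : P U = U) (hU0 : U ≠ 0) (hh : P h = 0) :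
    ∫ x, dualityMap p.toReal (toFun U x) * toFun h x ∂μH = 0 := by
  have hp1 : 1 ≤ p := Fact.out
  have hq1 : 1 ≤ p.toReal := by
    rw [← ENNReal.toReal_one]; exact ENNReal.toReal_mono hp hp1
  have hm : ∀ u : hardySpace p, MemLp (toFun u) (ENNReal.ofReal p.toReal) μH := fun u => by
    rw [ENNReal.ofReal_toReal hp]; exact memLp_toFun u
  refine integral_dualityMap_mul_eq_zero hq1 (hm U) (hm h) (ae_ne_zero hU0) fun t => ?_
  -- `P` maps `U + t h` to `U` without increasing the norm, so `U` is Birkhoff orthogonal to `h`.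
  have h1 : ‖U‖ ≤ ‖U + t • h‖ := by
    have h2 : P (U + t • h) = U := by rw [map_add, map_smul, hU, hh, smul_zero, add_zero]
    calc ‖U‖ = ‖P (U + t • h)‖ := by rw [h2]
      _ ≤ ‖P‖ * ‖U + t • h‖ := P.le_opNorm _
      _ ≤ ‖U + t • h‖ := mul_le_of_le_one_left (norm_nonneg _) hP
  have h3 := Real.rpow_le_rpow (norm_nonneg _) h1 (by linarith : 0 ≤ p.toReal)
  rw [norm_rpow_eq_integral hp, norm_rpow_eq_integral hp] at h3
  refine h3.trans_eq (integral_congr_ae ?_)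
  filter_upwards [toFun_add U (t • h), toFun_smul t h] with x hx hx'
  rw [hx, Pi.add_apply, hx', Pi.smul_apply, smul_eq_mul]

/-- A contractive projection onto the span of two independent elements gives a model. -/
theorem exists_isContractiveModel (hp : p ≠ ∞) {P : hardySpace p →L[ℂ] hardySpace p}
    (hP : ‖P‖ ≤ 1) {e₀ e₁ : hardySpace p} (h₀ : P e₀ = e₀) (h₁ : P e₁ = e₁)
    (hspan : ∀ u, ∃ a b : ℂ, P u = a • e₀ + b • e₁)
    (hind : ∀ a b : ℂ, a • e₀ + b • e₁ = 0 → a = 0 ∧ b = 0) :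
    ∃ V R, IsContractiveModel p.toReal V R ∧ IsPair V (toFun e₀) (toFun e₁) := by
  have hp1 : 1 ≤ p := Fact.out
  -- Fixed representatives of `e₀` and `e₁` span a space of genuine functions, so identities within
  -- `V` hold pointwise rather than almost everywhere.
  set V : Submodule ℂ (𝕋 → ℂ) := Submodule.span ℂ {toFun e₀, toFun e₁} with hV
  have hmem : ∀ y, y ∈ V ↔ ∃ a b : ℂ, a • toFun e₀ + b • toFun e₁ = y := fun y =>
    Submodule.mem_span_pair
  have hne : ∀ a b : ℂ, a • toFun e₀ + b • toFun e₁ ≠ 0 → a • e₀ + b • e₁ ≠ 0 := by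
    intro a b h h0
    obtain ⟨rfl, rfl⟩ := hind a b h0
    simp at h
  have hfix : ∀ a b : ℂ, P (a • e₀ + b • e₁) = a • e₀ + b • e₁ := fun a b => by
    rw [map_add, map_smul, map_smul, h₀, h₁]
  have hR : ∀ (n : ℕ) (y : 𝕋 → ℂ), ∃ r : 𝕋 → ℂ, y ∈ V → r ∈ V ∧ ∀ F ∈ V, F ≠ 0 →
      ∫ x, dualityMap p.toReal (F x) * (fourier n x * y x - r x) ∂μH = 0 := by
    intro n y
    by_cases hy : y ∈ V
    swap
    · exact ⟨0, fun h => absurd h hy⟩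
    obtain ⟨a, b, rfl⟩ := (hmem y).1 hy
    obtain ⟨v, hv⟩ := exists_shift (a • e₀ + b • e₁) n
    obtain ⟨α, β, hPv⟩ := hspan v
    refine ⟨α • toFun e₀ + β • toFun e₁, fun _ => ⟨(hmem _).2 ⟨α, β, rfl⟩, fun F hF hF0 => ?_⟩⟩
    obtain ⟨c, d, rfl⟩ := (hmem F).1 hF
    have hPh : P (v - (α • e₀ + β • e₁)) = 0 := by rw [map_sub, hfix, hPv, sub_self]
    rw [← integral_dualityMap_eq_zero hp hP (hfix c d) (hne c d hF0) hPh]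
    refine integral_congr_ae ?_
    filter_upwards [toFun_smul_add_smul c d e₀ e₁, toFun_smul_add_smul a b e₀ e₁,
      toFun_smul_add_smul α β e₀ e₁, toFun_sub v (α • e₀ + β • e₁), hv] with x k1 k2 k3 k4 k5
    rw [k1, k4, Pi.sub_apply, k5, k2, k3]
  choose R hR using hR
  refine ⟨V, R, ⟨?_, ?_, ?_, fun n y hy => (hR n y hy).1,
    fun n y hy F hF hF0 => (hR n y hy).2 F hF hF0⟩, ⟨?_, ?_, ?_, ?_⟩⟩
  · rw [← ENNReal.toReal_one]; exact ENNReal.toReal_mono hp hp1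
  · intro y hy
    obtain ⟨a, b, rfl⟩ := (hmem y).1 hy
    rw [ENNReal.ofReal_toReal hp]
    exact ((memLp_toFun e₀).const_smul a).add ((memLp_toFun e₁).const_smul b)
  · intro y hy hy0
    obtain ⟨a, b, rfl⟩ := (hmem y).1 hy
    filter_upwards [toFun_smul_add_smul a b e₀ e₁, ae_ne_zero (hne a b hy0)] with x hx hx'
    rwa [← hx]
  · exact Submodule.subset_span (by simp)
  · exact Submodule.subset_span (by simp)
  · intro y hy
    obtain ⟨a, b, rfl⟩ := (hmem y).1 hy
    exact ⟨a, b, rfl⟩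
  · intro a b hab
    refine hind a b (eq_zero_of_toFun ?_)
    filter_upwards [toFun_smul_add_smul a b e₀ e₁] with x hx
    rw [hx, hab]

end hardySpace

theorem mainTheorem2 (p : ℝ≥0∞) [Fact (1 ≤ p)] (hp : p ≠ ∞) (hp2 : p ≠ 2) :
    ¬ ∃ b : SchauderBasis ℂ (hardySpace p), b.enormProjBound = 1 := by
  rintro ⟨b, hb⟩
  have hP : ‖b.proj 2‖ ≤ 1 := by
    have h := b.enorm_proj_le_enormProjBound 2
    rw [hb, ← ofReal_norm] at h
    exact ENNReal.ofReal_le_one.1 h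
  have hind : ∀ c d : ℂ, c • b 0 + d • b 1 = 0 → c = 0 ∧ d = 0 := by
    intro c d h
    have h0 := congrArg (b.coord 0) h
    have h1 := congrArg (b.coord 1) h
    simp only [map_add, map_smul, b.ortho, map_zero] at h0 h1
    exact ⟨by simpa using h0, by simpa using h1⟩
  obtain ⟨V, R, hV, hVp⟩ := hardySpace.exists_isContractiveModel hp hP (e₀ := b 0) (e₁ := b 1)
    (by simpa only [Nat.ofNat_pos, if_true] using b.proj_apply_basis_mem 2 0)
    (by simpa only [Nat.one_lt_ofNat, if_true] using b.proj_apply_basis_mem 2 1)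
    (fun u => ⟨b.coord 0 u, b.coord 1 u, by rw [b.proj_apply, Finset.sum_range_succ,
      Finset.sum_range_one]⟩) hind
  have hne : p.toReal ≠ 2 := fun h => hp2 (by
    rw [← ENNReal.ofReal_toReal hp, h]; norm_num)
  rcases lt_or_gt_of_ne hne with h | h
  · exact hV.false_of_lt_two h hVp
  · exact hV.false_of_two_lt h hVp
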